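/- For integers $k\ge 1$ and $n\ge k+2$ let $$\tau_{n,k}:=\frac{|T_n^{(k)}(\omega_{n,k})|}{T_n^{(k)}(1)},$$ where $T_n$ is the Chebyshev polynomial of the first kind of degree $n$ and $\omega_{n,k}$ is the rightmost zero of $T_n^{(k+1)}$. Then: (i) for every integer $m\ge 0$ there is a constant $C_m>0$, depending only on $m$, such that $$\tau_{n,k}\le C_m\,k^{-m/2}\qquad\text{for all } k\ge 1 \text{ and } n\ge \max(k+2,\,k+m);$$ (ii) there is an absolute constant $C>0$ such that $$\tau_{n,k}\le C\Big(\frac{4}{\sqrt{27}}\Big)^k\qquad\text{for all } k\ge 1 \text{ and } n\ge \max(k+2,\,2k);$$ (iii) there is an absolute constant $C'>0$ such that $$\tau_{n,k}\le C'\Big(\frac{2}{e}\Big)^k\qquad\text{for all } k\ge 1 \text{ and } n\ge \max(k+2,\,k^{3/2}).$$ -/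

import Mathlib

open Polynomial

/-- The `k`-th derivative `T_n^{(k)}` of the Chebyshev polynomial of the first kind of degree `n`. -/
noncomputable def chebDeriv (n k : ℕ) : ℝ[X] :=
  derivative^[k] (Polynomial.Chebyshev.T ℝ (n : ℤ))

/-- The rightmost real zero `ω_{n,k}` of `T_n^{(k+1)}`; for `k + 2 ≤ n` it exists and is the greatest
element of the set of zeros, see `isGreatest_rightmostZero`. -/
noncomputable def rightmostZero (n k : ℕ) : ℝ :=
  sSup {x : ℝ | (chebDeriv n (k + 1)).eval x = 0}

/-- `τ_{n,k} = |T_n^{(k)}(ω_{n,k})| / T_n^{(k)}(1)`, meaningful for `k + 2 ≤ n`. -/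
noncomputable def chebTau (n k : ℕ) : ℝ :=
  |(chebDeriv n k).eval (rightmostZero n k)| / (chebDeriv n k).eval 1

/-- The denominator of `chebTau` is positive. -/
theorem chebDeriv_eval_one_pos {n k : ℕ} (h : k ≤ n) : 0 < (chebDeriv n k).eval 1 := by
  unfold chebDeriv
  rw [Polynomial.Chebyshev.iterate_derivative_T_eval_one_eq_div]
  apply div_pos
  · push_cast
    apply Finset.prod_pos
    intro l hl
    have hl' : (l : ℝ) < n := by
      exact_mod_cast lt_of_lt_of_le (Finset.mem_range.mp hl) h
    have : (0 : ℝ) ≤ l := Nat.cast_nonneg l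
    nlinarith
  · exact_mod_cast Finset.prod_pos (fun l _ => by positivity)

/-- `T_n^{(k)}` has at least `n - k` real zeros, counted with multiplicity. -/
theorem chebDeriv_card_roots (n k : ℕ) : n ≤ (chebDeriv n k).roots.card + k := by
  induction k with
  | zero =>
    simp only [chebDeriv, Function.iterate_zero, id_eq, add_zero]
    rw [Polynomial.Chebyshev.roots_T_real, Finset.image_val]
    have h := Polynomial.Chebyshev.roots_T_real_nodup n
    simp only [Finset.range_val]
    rw [Multiset.dedup_eq_self.mpr h]
    simp
  | succ k ih =>
    have h := Polynomial.card_roots_le_derivative (chebDeriv n k)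
    have e : derivative (chebDeriv n k) = chebDeriv n (k + 1) := by
      simp [chebDeriv, Function.iterate_succ_apply']
    rw [e] at h
    omega

/-- For `k + 2 ≤ n`, `rightmostZero n k` is indeed the rightmost zero of `T_n^{(k+1)}`. -/
theorem isGreatest_rightmostZero {n k : ℕ} (h : k + 2 ≤ n) :
    IsGreatest {x : ℝ | (chebDeriv n (k + 1)).eval x = 0} (rightmostZero n k) := by
  have h0 : chebDeriv n (k + 1) ≠ 0 := by
    intro h0
    have := chebDeriv_eval_one_pos (n := n) (k := k + 1) (by omega)
    simp [h0] at this
  have hS : {x : ℝ | (chebDeriv n (k + 1)).eval x = 0}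
      = ((chebDeriv n (k + 1)).roots.toFinset : Set ℝ) := by
    ext x
    simp [h0]
  have hne : ({x : ℝ | (chebDeriv n (k + 1)).eval x = 0}).Nonempty := by
    have hc := chebDeriv_card_roots n (k + 1)
    obtain ⟨x, hx⟩ := Multiset.card_pos_iff_exists_mem.mp
      (show 0 < (chebDeriv n (k + 1)).roots.card by omega)
    exact ⟨x, (Polynomial.mem_roots h0).mp hx⟩
  have hfin : ({x : ℝ | (chebDeriv n (k + 1)).eval x = 0}).Finite := by
    rw [hS]; exact Finset.finite_toSet _
  exact ⟨hne.csSup_mem hfin, fun x hx => le_csSup hfin.bddAbove hx⟩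

/-! Up to a factor depending only on `n` and `k`, `T_n^{(k)}` is the Gegenbauer polynomial
`C_{n-k}^{(k)}`, whose value at `x` is the coefficient of `z^{n-k}` in `(1 - 2xz + z²)^{-k}`. On
`|z| = R < 1` the modulus of `1 - 2xz + z²` is at least `(1 - R²)σ` with `σ = √(1 - x²)`. Cauchy's
estimate at the optimal radius `R² = (n-k)/(n+k)`, divided by the value at `1` (a binomial
coefficient, handled by Stirling), bounds `τ` by a prefactor times `R^{n-k} (2k/((n+k)σ))^k`
(`chebTau_le`).

The zero `ω` enters through `σ` alone. In Liouville normal form the differential equation of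
`T_n^{(k+1)}` becomes `v'' = (k(k+1)/sin²θ - n²) v`. Starting from `θ = 0`, `v` stays positive up to
the turning point, so `nσ > k` at `ω` (`mul_succ_lt_of_rightmostZero`). Hence the rate `chebRate`,
which is `exp(k · logRate(n/k))`. The function `logRate` decreases, equals `log(4/√27)` at `2`, and
is at most `log 2 - 1 + a⁻²`. This gives the bases in (ii) and (iii), and the correction `k(k/n)² ≤
1` accounts for the threshold `k^{3/2}`.

The prefactor in `chebTau_le` is unbounded. For `n ≥ 2k` it is removed in two moves. Integrating
over the circle, instead of taking the minimum, reduces it to `√(nσ)` (`chebTau_le_of_two_mul_le`).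
A Sturm comparison pushes `ω` further inside, to `(nσ/k)² ≥ 1 + k^{-2/3}`, so that `(nσ/k)^k`
absorbs `√(nσ)` (`chebTau_le_const_mul_rate`).

For (i), the range `n ≥ 2k` follows from (ii). When `N = n - k < k`, the rate is at most the `N`-th
power of a base that is both `O(N/√k)` and at most `√(e/3) < 1`; the first bound is spent on `m`
factors and the second on the rest (`chebTau_le_of_lt_two_mul`). -/

/-! ### Differential equation, parity and sign of the derivatives -/

theorem derivative_chebDeriv (n k : ℕ) :
    derivative (chebDeriv n k) = chebDeriv n (k + 1) := by
  simp [chebDeriv, Function.iterate_succ_apply']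

theorem hasDerivAt_chebDeriv (n k : ℕ) (x : ℝ) :
    HasDerivAt (fun y => (chebDeriv n k).eval y) ((chebDeriv n (k + 1)).eval x) x := by
  rw [← derivative_chebDeriv]
  exact (chebDeriv n k).hasDerivAt x

/-- The ultraspherical differential equation satisfied by `T_n^{(k)}`. -/
theorem chebDeriv_ode (n k : ℕ) (x : ℝ) :
    (1 - x ^ 2) * (chebDeriv n (k + 2)).eval x =
      (2 * k + 1) * x * (chebDeriv n (k + 1)).eval x
        - ((n : ℝ) ^ 2 - (k : ℝ) ^ 2) * (chebDeriv n k).eval x := by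
  have := Polynomial.Chebyshev.one_sub_X_sq_mul_iterate_derivative_T_eval (R := ℝ) (n : ℤ) k x
  simpa [chebDeriv] using this

theorem chebDeriv_eval_neg (n k : ℕ) (x : ℝ) :
    (chebDeriv n k).eval (-x) = (-1) ^ (n + k) * (chebDeriv n k).eval x := by
  induction k generalizing x with
  | zero =>
    simp [chebDeriv, Int.negOnePow, Polynomial.Chebyshev.T_eval_neg]
  | succ k ih =>
    have h1 : HasDerivAt (fun y => (chebDeriv n k).eval (-y))
        ((chebDeriv n (k + 1)).eval (-x) * (-1)) x :=
      (hasDerivAt_chebDeriv n k (-x)).comp x (hasDerivAt_neg x)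
    have h2 := (hasDerivAt_chebDeriv n k x).const_mul ((-1 : ℝ) ^ (n + k))
    have h3 : (fun y => (chebDeriv n k).eval (-y))
        = fun y => (-1 : ℝ) ^ (n + k) * (chebDeriv n k).eval y := funext ih
    rw [h3] at h1
    have := h1.unique h2
    rw [← add_assoc, pow_succ]
    linarith

/-- All Taylor coefficients at `1` are nonnegative, being values of higher derivatives at `1`, and
the constant one is positive. -/
theorem chebDeriv_pos_of_one_le {n k : ℕ} (h : k ≤ n) {x : ℝ} (hx : 1 ≤ x) :
    0 < (chebDeriv n k).eval x := by
  have h1 : ∀ j, derivative^[j] (chebDeriv n k) = chebDeriv n (j + k) := by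
    intro j; simp [chebDeriv, Function.iterate_add_apply]
  have hnn : ∀ j, 0 ≤ (chebDeriv n j).eval 1 := by
    intro j
    rcases le_or_gt j n with hj | hj
    · exact (chebDeriv_eval_one_pos hj).le
    · have : chebDeriv n j = 0 := by
        unfold chebDeriv
        apply Polynomial.iterate_derivative_eq_zero
        rw [Polynomial.Chebyshev.natDegree_T]; simpa using hj
      simp [this]
  have h2 : (chebDeriv n k).eval x = ((taylor 1 (chebDeriv n k))).eval (x - 1) := by
    simp [taylor_eval]
  have hc : ∀ j, 0 ≤ (taylor 1 (chebDeriv n k)).coeff j := by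
    intro j
    have h3 : (j.factorial : ℝ) * (taylor 1 (chebDeriv n k)).coeff j
        = (chebDeriv n (j + k)).eval 1 := by
      rw [taylor_coeff, ← h1 j, ← Polynomial.factorial_smul_hasseDeriv]
      simp
    have h4 := hnn (j + k)
    rw [← h3] at h4
    exact nonneg_of_mul_nonneg_right h4 (by positivity)
  rw [h2, eval_eq_sum_range, Finset.sum_range_succ']
  have h0 : 0 < (taylor 1 (chebDeriv n k)).coeff 0 := by
    rw [taylor_coeff_zero]; exact chebDeriv_eval_one_pos h
  have : 0 ≤ ∑ i ∈ Finset.range (taylor 1 (chebDeriv n k)).natDegree,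
      (taylor 1 (chebDeriv n k)).coeff (i + 1) * (x - 1) ^ (i + 1) :=
    Finset.sum_nonneg fun i _ => mul_nonneg (hc _) (pow_nonneg (by linarith) _)
  simp only [pow_zero, mul_one]
  linarith

theorem eval_rightmostZero {n k : ℕ} (h : k + 2 ≤ n) :
    (chebDeriv n (k + 1)).eval (rightmostZero n k) = 0 :=
  (isGreatest_rightmostZero h).1

theorem rightmostZero_lt_one {n k : ℕ} (h : k + 2 ≤ n) : rightmostZero n k < 1 := by
  by_contra! hx
  have := chebDeriv_pos_of_one_le (n := n) (k := k + 1) (by omega) hx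
  rw [eval_rightmostZero h] at this
  exact this.false

theorem rightmostZero_nonneg {n k : ℕ} (h : k + 2 ≤ n) : 0 ≤ rightmostZero n k := by
  by_contra! hx
  have h1 : (chebDeriv n (k + 1)).eval (-rightmostZero n k) = 0 := by
    rw [chebDeriv_eval_neg, eval_rightmostZero h, mul_zero]
  have := (isGreatest_rightmostZero h).2 h1
  linarith

theorem chebDeriv_pos_of_rightmostZero_lt {n k : ℕ} (h : k + 2 ≤ n) {x : ℝ}
    (hx : rightmostZero n k < x) : 0 < (chebDeriv n (k + 1)).eval x := by
  by_contra! hneg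
  have h1 : 0 < (chebDeriv n (k + 1)).eval (max x 1) :=
    chebDeriv_pos_of_one_le (by omega) (le_max_right _ _)
  obtain ⟨y, hy, hy0⟩ := intermediate_value_Icc (le_max_left x 1)
    (chebDeriv n (k + 1)).continuous.continuousOn (Set.mem_Icc.mpr ⟨hneg, h1.le⟩)
  have := (isGreatest_rightmostZero h).2 hy0
  linarith [hy.1]

/-! ### Sturm comparison -/

/-- Comparison with a cosine: a solution of `f'' + Q² f ≥ 0` starting at a positive value with
nonnegative slope stays positive for a time `π / (2 Q)`. -/
theorem pos_of_cos_comparison {f f' f'' : ℝ → ℝ} {a b Q : ℝ} (hab : a ≤ b) (hQ : 0 ≤ Q)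
    (hf : ∀ t, HasDerivAt f (f' t) t) (hf' : ∀ t, HasDerivAt f' (f'' t) t)
    (hode : ∀ t ∈ Set.Icc a b, 0 ≤ f'' t + Q ^ 2 * f t)
    (ha : 0 < f a) (ha' : 0 ≤ f' a) (hlen : Q * (b - a) < Real.pi / 2) : 0 < f b := by
  have hcos : ∀ t ∈ Set.Icc a b, 0 < Real.cos (Q * (t - a)) := by
    intro t ht
    apply Real.cos_pos_of_mem_Ioo
    constructor
    · have : 0 ≤ Q * (t - a) := mul_nonneg hQ (by linarith [ht.1])
      linarith [Real.pi_pos]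
    · exact lt_of_le_of_lt (mul_le_mul_of_nonneg_left (by linarith [ht.2]) hQ) hlen
  have hlin : ∀ t : ℝ, HasDerivAt (fun t => Q * (t - a)) Q t := by
    intro t; simpa using ((hasDerivAt_id t).sub_const a).const_mul Q
  have hc : ∀ t : ℝ, HasDerivAt (fun t => Real.cos (Q * (t - a)))
      (-Real.sin (Q * (t - a)) * Q) t := fun t => (hlin t).cos
  have hs : ∀ t : ℝ, HasDerivAt (fun t => Real.sin (Q * (t - a)))
      (Real.cos (Q * (t - a)) * Q) t := fun t => (hlin t).sin
  -- The Wronskian of `f` and the cosine: it increases by the differential inequality, and `W /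
  -- cos²` is the derivative of `f / cos`.
  set W : ℝ → ℝ := fun t => f' t * Real.cos (Q * (t - a)) + Q * (f t * Real.sin (Q * (t - a)))
    with hW
  have hWd : ∀ t, HasDerivAt W ((f'' t + Q ^ 2 * f t) * Real.cos (Q * (t - a))) t := by
    intro t
    refine HasDerivAt.congr_deriv (f := W)
      (((hf' t).mul (hc t)).add (((hf t).mul (hs t)).const_mul Q)) ?_
    ring
  have hWmono : MonotoneOn W (Set.Icc a b) := by
    apply monotoneOn_of_deriv_nonneg (convex_Icc a b)
    · exact fun t _ => (hWd t).continuousAt.continuousWithinAt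
    · exact fun t _ => (hWd t).differentiableAt.differentiableWithinAt
    · intro t ht
      rw [(hWd t).deriv]
      have ht' := interior_subset ht
      exact mul_nonneg (hode t ht') (hcos t ht').le
  have hWnn : ∀ t ∈ Set.Icc a b, 0 ≤ W t := by
    intro t ht
    refine le_trans ?_ (hWmono (Set.left_mem_Icc.mpr hab) ht ht.1)
    simpa [hW] using ha'
  have hgd : ∀ t ∈ Set.Icc a b, HasDerivAt (fun t => f t / Real.cos (Q * (t - a)))
      (W t / Real.cos (Q * (t - a)) ^ 2) t := by
    intro t ht
    refine ((hf t).div (hc t) (hcos t ht).ne').congr_deriv ?_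
    simp only [hW]; ring
  have hgmono : MonotoneOn (fun t => f t / Real.cos (Q * (t - a))) (Set.Icc a b) := by
    apply monotoneOn_of_deriv_nonneg (convex_Icc a b)
    · exact fun t ht => (hgd t ht).continuousAt.continuousWithinAt
    · exact fun t ht => (hgd t (interior_subset ht)).differentiableAt.differentiableWithinAt
    · intro t ht
      rw [(hgd t (interior_subset ht)).deriv]
      exact div_nonneg (hWnn t (interior_subset ht)) (sq_nonneg _)
  have h1 := hgmono (Set.left_mem_Icc.mpr hab) (Set.right_mem_Icc.mpr hab) hab
  simp only [sub_self, mul_zero, Real.cos_zero, div_one] at h1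
  have h2 := lt_of_lt_of_le ha h1
  exact (div_pos_iff_of_pos_right (hcos b (Set.right_mem_Icc.mpr hab))).mp h2

/-! ### Location of the rightmost zero -/

/-- The Liouville transform `sin^{k+1} θ · T_n^{(k+1)}(cos θ)`. -/
noncomputable def chebLiouville (n k : ℕ) (t : ℝ) : ℝ :=
  Real.sin t ^ (k + 1) * (chebDeriv n (k + 1)).eval (Real.cos t)

/-- The derivative of `chebLiouville`. -/
noncomputable def chebLiouvilleDeriv (n k : ℕ) (t : ℝ) : ℝ :=
  (k + 1) * Real.sin t ^ k * Real.cos t * (chebDeriv n (k + 1)).eval (Real.cos t)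
    - Real.sin t ^ (k + 2) * (chebDeriv n (k + 2)).eval (Real.cos t)

theorem hasDerivAt_chebDeriv_cos (n k : ℕ) (t : ℝ) :
    HasDerivAt (fun t => (chebDeriv n k).eval (Real.cos t))
      ((chebDeriv n (k + 1)).eval (Real.cos t) * (-Real.sin t)) t :=
  (hasDerivAt_chebDeriv n k (Real.cos t)).comp t (Real.hasDerivAt_cos t)

theorem hasDerivAt_chebLiouville (n k : ℕ) (t : ℝ) :
    HasDerivAt (chebLiouville n k) (chebLiouvilleDeriv n k t) t := by
  have h := ((Real.hasDerivAt_sin t).pow (k + 1)).mul (hasDerivAt_chebDeriv_cos n (k + 1) t)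
  refine HasDerivAt.congr_deriv (f := chebLiouville n k) h ?_
  simp only [chebLiouvilleDeriv, Pi.pow_apply, Nat.add_sub_cancel]
  push_cast
  ring

/-- The normal form `v'' = ((k+1)(k+2)/sin² - n²) v`, with the division by `sin²` carried out. The
index is shifted by one so that the remaining exponent of `sin` is a natural number. -/
theorem hasDerivAt_chebLiouvilleDeriv (n k : ℕ) (t : ℝ) :
    HasDerivAt (chebLiouvilleDeriv n (k + 1))
      (Real.sin t ^ k * (chebDeriv n (k + 2)).eval (Real.cos t)
        * ((k + 1) * (k + 2) - (n : ℝ) ^ 2 * Real.sin t ^ 2)) t := by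
  have h1 := ((((Real.hasDerivAt_sin t).pow (k + 1)).const_mul (((k + 1 : ℕ) : ℝ) + 1)).mul
    (Real.hasDerivAt_cos t)).mul (hasDerivAt_chebDeriv_cos n (k + 2) t)
  have h2 := ((Real.hasDerivAt_sin t).pow (k + 3)).mul (hasDerivAt_chebDeriv_cos n (k + 3) t)
  refine HasDerivAt.congr_deriv (f := chebLiouvilleDeriv n (k + 1)) (h1.sub h2) ?_
  have ode := chebDeriv_ode n (k + 2) (Real.cos t)
  have hs := Real.sin_sq_add_cos_sq t
  rw [show 1 - Real.cos t ^ 2 = Real.sin t ^ 2 by linarith] at ode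
  have hc : Real.cos t ^ 2 = 1 - Real.sin t ^ 2 := by linarith
  simp only [Pi.pow_apply, Pi.mul_apply, Nat.add_sub_cancel, show k + 3 - 1 = k + 2 from rfl]
  push_cast at ode ⊢
  set c := Real.cos t
  set s := Real.sin t
  linear_combination (s ^ (k + 2)) * ode
    + ((s ^ k * (k + 1) * (k + 2)) * (chebDeriv n (k + 2)).eval c) * hc

theorem cos_arccos_rightmostZero {n k : ℕ} (h : k + 2 ≤ n) :
    Real.cos (Real.arccos (rightmostZero n k)) = rightmostZero n k :=
  Real.cos_arccos (by linarith [rightmostZero_nonneg h]) (rightmostZero_lt_one h).le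

theorem sin_sq_arccos_rightmostZero {n k : ℕ} (h : k + 2 ≤ n) :
    Real.sin (Real.arccos (rightmostZero n k)) ^ 2 = 1 - rightmostZero n k ^ 2 := by
  rw [Real.sin_sq, cos_arccos_rightmostZero h]

theorem arccos_rightmostZero_pos {n k : ℕ} (h : k + 2 ≤ n) :
    0 < Real.arccos (rightmostZero n k) :=
  Real.arccos_pos.mpr (rightmostZero_lt_one h)

theorem arccos_rightmostZero_le {n k : ℕ} (h : k + 2 ≤ n) :
    Real.arccos (rightmostZero n k) ≤ Real.pi / 2 :=
  Real.arccos_le_pi_div_two.mpr (rightmostZero_nonneg h)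

theorem chebDeriv_cos_pos {n k : ℕ} (h : k + 2 ≤ n) {t : ℝ} (ht : 0 ≤ t)
    (ht' : t < Real.arccos (rightmostZero n k)) :
    0 < (chebDeriv n (k + 1)).eval (Real.cos t) := by
  apply chebDeriv_pos_of_rightmostZero_lt h
  rw [← cos_arccos_rightmostZero h]
  exact Real.cos_lt_cos_of_nonneg_of_le_pi_div_two ht (arccos_rightmostZero_le h) ht'

theorem chebDeriv_cos_nonneg {n k : ℕ} (h : k + 2 ≤ n) {t : ℝ} (ht : 0 ≤ t)
    (ht' : t ≤ Real.arccos (rightmostZero n k)) :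
    0 ≤ (chebDeriv n (k + 1)).eval (Real.cos t) := by
  rcases ht'.lt_or_eq with h1 | h1
  · exact (chebDeriv_cos_pos h ht h1).le
  · rw [h1, cos_arccos_rightmostZero h, eval_rightmostZero h]

theorem chebLiouville_arccos_rightmostZero {n k : ℕ} (h : k + 2 ≤ n) :
    chebLiouville n k (Real.arccos (rightmostZero n k)) = 0 := by
  rw [chebLiouville, cos_arccos_rightmostZero h, eval_rightmostZero h, mul_zero]

/-- Up to the turning point, the Liouville transform is positive and increasing. -/
theorem chebLiouville_pos_of_le_turning {n k : ℕ} (h : k + 3 ≤ n) {a : ℝ} (ha : 0 < a)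
    (ha' : a ≤ Real.arccos (rightmostZero n (k + 1)))
    (hturn : (n : ℝ) ^ 2 * Real.sin a ^ 2 ≤ (k + 1) * (k + 2)) :
    0 < chebLiouville n (k + 1) a ∧ 0 ≤ chebLiouvilleDeriv n (k + 1) a := by
  have h' : (k + 1) + 2 ≤ n := by omega
  have hpi := arccos_rightmostZero_le h'
  have hsin0 : ∀ t ∈ Set.Icc 0 a, 0 ≤ Real.sin t := fun t ht =>
    Real.sin_nonneg_of_nonneg_of_le_pi ht.1 (by linarith [ht.2, Real.pi_pos])
  have hmono' : MonotoneOn (chebLiouvilleDeriv n (k + 1)) (Set.Icc 0 a) := by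
    apply monotoneOn_of_deriv_nonneg (convex_Icc 0 a)
    · exact fun t _ => (hasDerivAt_chebLiouvilleDeriv n k t).continuousAt.continuousWithinAt
    · exact fun t _ =>
        (hasDerivAt_chebLiouvilleDeriv n k t).differentiableAt.differentiableWithinAt
    · intro t ht
      rw [(hasDerivAt_chebLiouvilleDeriv n k t).deriv]
      have ht' := interior_subset ht
      have hs := hsin0 t ht'
      have hle : Real.sin t ≤ Real.sin a :=
        Real.sin_le_sin_of_le_of_le_pi_div_two (by linarith [ht'.1, Real.pi_pos])
          (by linarith) ht'.2
      refine mul_nonneg (mul_nonneg (pow_nonneg hs _)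
        (chebDeriv_cos_nonneg h' ht'.1 (ht'.2.trans ha'))) ?_
      have : (n : ℝ) ^ 2 * Real.sin t ^ 2 ≤ (n : ℝ) ^ 2 * Real.sin a ^ 2 := by gcongr
      linarith
  have hnn : ∀ t ∈ Set.Icc 0 a, 0 ≤ chebLiouvilleDeriv n (k + 1) t := by
    intro t ht
    have := hmono' (Set.left_mem_Icc.mpr ha.le) ht ht.1
    simpa [chebLiouvilleDeriv] using this
  have hmono : MonotoneOn (chebLiouville n (k + 1)) (Set.Icc 0 a) := by
    apply monotoneOn_of_deriv_nonneg (convex_Icc 0 a)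
    · exact fun t _ => (hasDerivAt_chebLiouville n (k + 1) t).continuousAt.continuousWithinAt
    · exact fun t _ =>
        (hasDerivAt_chebLiouville n (k + 1) t).differentiableAt.differentiableWithinAt
    · intro t ht
      rw [(hasDerivAt_chebLiouville n (k + 1) t).deriv]
      exact hnn t (interior_subset ht)
  refine ⟨?_, hnn a (Set.right_mem_Icc.mpr ha.le)⟩
  have hhalf : 0 < chebLiouville n (k + 1) (a / 2) := by
    apply mul_pos
    · exact pow_pos (Real.sin_pos_of_pos_of_lt_pi (by linarith) (by linarith)) _
    · exact chebDeriv_cos_pos h' (by linarith) (by linarith)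
  exact lt_of_lt_of_le hhalf (hmono ⟨by linarith, by linarith⟩ ⟨ha.le, le_rfl⟩ (by linarith))

/-- The rightmost zero lies strictly inside the oscillatory region. -/
theorem mul_succ_lt_of_rightmostZero {n k : ℕ} (hk : 1 ≤ k) (h : k + 2 ≤ n) :
    (k : ℝ) * (k + 1) < (n : ℝ) ^ 2 * (1 - rightmostZero n k ^ 2) := by
  obtain ⟨j, rfl⟩ : ∃ j, k = j + 1 := ⟨k - 1, by omega⟩
  by_contra! hcon
  rw [← sin_sq_arccos_rightmostZero h] at hcon
  -- If the zero lay at or before the turning point, the transform would be positive there.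
  have := (chebLiouville_pos_of_le_turning (by omega) (arccos_rightmostZero_pos h) le_rfl
    (by push_cast at hcon; linarith)).1
  rw [chebLiouville_arccos_rightmostZero h] at this
  exact this.false

/-- For `2k ≤ n` the rightmost zero lies at a relative distance `k^{-2/3}` inside the oscillatory
region. -/
theorem sq_mul_one_add_le_of_rightmostZero {n k : ℕ} (hk : 1 ≤ k) (h : k + 2 ≤ n)
    (hn : 2 * k ≤ n) {ε : ℝ} (hε : 0 ≤ ε) (hε1 : ε ≤ 1) (hεk : (k : ℝ) ^ 2 * ε ^ 3 ≤ 1) :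
    (k : ℝ) ^ 2 * (1 + ε) ≤ (n : ℝ) ^ 2 * (1 - rightmostZero n k ^ 2) := by
  have hlt := mul_succ_lt_of_rightmostZero hk h
  obtain ⟨j, rfl⟩ : ∃ j, k = j + 1 := ⟨k - 1, by omega⟩
  by_contra! hcon
  rw [← sin_sq_arccos_rightmostZero h] at hcon hlt
  have hz := chebLiouville_arccos_rightmostZero h
  have hb0 := arccos_rightmostZero_pos h
  have hb1 := arccos_rightmostZero_le h
  have hg := fun t => @chebDeriv_cos_nonneg n (j + 1) h t
  have hturn := fun a => @chebLiouville_pos_of_le_turning n j (by omega) a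
  set b := Real.arccos (rightmostZero n (j + 1)) with hb
  set K : ℝ := ((j + 1 : ℕ) : ℝ) with hK
  have hKj : (j : ℝ) + 1 = K := by simp [hK]
  have hK1 : 1 ≤ K := by rw [hK]; exact_mod_cast hk
  have hnK : 2 * K ≤ n := by rw [hK]; exact_mod_cast hn
  have hn0 : (0 : ℝ) < n := by linarith
  have hsb : 0 < Real.sin b := Real.sin_pos_of_pos_of_lt_pi hb0 (by linarith [Real.pi_pos])
  set S : ℝ := √(K * (K + 1)) with hS
  have hS2 : S ^ 2 = K * (K + 1) := Real.sq_sqrt (by positivity)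
  have hS0 : 0 ≤ S := Real.sqrt_nonneg _
  have hSK : K ≤ S := by
    apply Real.le_sqrt_of_sq_le; nlinarith
  have hSb : S < n * Real.sin b := by
    apply lt_of_pow_lt_pow_left₀ 2 (by positivity)
    rw [hS2, mul_pow]; exact hlt
  have hSn : S / n < Real.sin b := by rw [div_lt_iff₀ hn0]; linarith
  -- The turning point, `n² sin² a = K(K+1)`. The cosine comparison runs from here to the angle `b`
  -- of the zero, with frequency `n√ε`.
  set a := Real.arcsin (S / n) with ha
  have hsa : Real.sin a = S / n :=
    Real.sin_arcsin (by linarith [div_nonneg hS0 hn0.le]) (by linarith [Real.sin_le_one b])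
  have ha0 : 0 < a := Real.arcsin_pos.mpr (by positivity)
  have hab : a < b := by
    rw [ha, Real.arcsin_lt_iff_lt_sin' ⟨by linarith, hb1⟩]; exact hSn
  obtain ⟨hva, hva'⟩ := hturn a ha0 hab.le (by
    rw [hsa, div_pow, hS2, mul_div_cancel₀ _ (by positivity), ← hKj]
    linarith)
  -- length of the interval
  have hcb : (1 / 2 : ℝ) ≤ Real.cos b ^ 2 := by
    have h1 := Real.sin_sq_add_cos_sq b
    have h2 : (n : ℝ) ^ 2 * Real.sin b ^ 2 ≤ (n : ℝ) ^ 2 * (1 / 2) := by nlinarith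
    have := le_of_mul_le_mul_left h2 (by positivity)
    linarith
  have hcb0 : 0 ≤ Real.cos b := Real.cos_nonneg_of_mem_Icc ⟨by linarith, hb1⟩
  have hmvt : Real.cos b * (b - a) ≤ Real.sin b - Real.sin a := by
    apply Convex.mul_sub_le_image_sub_of_le_deriv (convex_Icc a b)
      Real.continuous_sin.continuousOn Real.differentiable_sin.differentiableOn
      _ a (Set.left_mem_Icc.mpr hab.le) b (Set.right_mem_Icc.mpr hab.le) hab.le
    intro t ht
    rw [Real.deriv_sin]
    have ht' := interior_subset ht
    exact Real.cos_le_cos_of_nonneg_of_le_pi (by linarith [ht'.1]) (by linarith [Real.pi_pos])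
      ht'.2
  have hdiff : 2 * n * (Real.sin b - Real.sin a) ≤ K * ε := by
    have e1 : (n * Real.sin b - S) * (n * Real.sin b + S) ≤ K ^ 2 * ε := by nlinarith
    have e2 : n * (Real.sin b - Real.sin a) = n * Real.sin b - S := by
      rw [hsa]; field_simp
    have e3 : (n * Real.sin b - S) * (2 * K) ≤ (n * Real.sin b - S) * (n * Real.sin b + S) := by
      apply mul_le_mul_of_nonneg_left <;> linarith
    have e4 : K * (2 * (n * Real.sin b - S)) ≤ K * (K * ε) := by linarith
    have := le_of_mul_le_mul_left e4 (by linarith)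
    linarith
  -- Since `n(b - a)` is at most of order `Kε`, the phase is at most of order `Kε^{3/2} ≤ 1`; this
  -- dictates `ε = K^{-2/3}`.
  have hlen : n * √ε * (b - a) < Real.pi / 2 := by
    have hpi := Real.pi_gt_three
    suffices n * √ε * (b - a) ≤ 1 by linarith
    have hba : 0 ≤ b - a := by linarith
    have e1 : 2 * n * (Real.cos b * (b - a)) ≤ K * ε :=
      (mul_le_mul_of_nonneg_left hmvt (by positivity)).trans hdiff
    have e2 : (2 * n * (Real.cos b * (b - a))) ^ 2 ≤ (K * ε) ^ 2 := by gcongr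
    have e3 : 2 * (n * (b - a)) ^ 2 ≤ (K * ε) ^ 2 := by
      have e5 : 1 / 2 * (n * (b - a)) ^ 2 ≤ Real.cos b ^ 2 * (n * (b - a)) ^ 2 :=
        mul_le_mul_of_nonneg_right hcb (sq_nonneg _)
      linarith only [e2, e5]
    have e4 : (n * √ε * (b - a)) ^ 2 ≤ 1 ^ 2 := by
      have : (n * √ε * (b - a)) ^ 2 = ε * (n * (b - a)) ^ 2 := by
        rw [mul_pow, mul_pow, Real.sq_sqrt hε]; ring
      rw [this]
      have e6 := mul_le_mul_of_nonneg_left e3 hε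
      linarith only [e6, hεk]
    exact (pow_le_pow_iff_left₀ (by positivity) (by norm_num) two_ne_zero).mp e4
  have hpos := pos_of_cos_comparison hab.le (by positivity)
    (hasDerivAt_chebLiouville n (j + 1)) (hasDerivAt_chebLiouvilleDeriv n j) (Q := n * √ε) ?_
    hva hva' hlen
  · rw [hz] at hpos
    exact hpos.false
  -- The inequality needed is `(1 - ε) n² sin² t ≤ K(K+1)`, which holds because `(1 - ε)(1 + ε) ≤
  -- 1`.
  · intro t ht
    have hs0 : 0 ≤ Real.sin t :=
      Real.sin_nonneg_of_nonneg_of_le_pi (by linarith [ht.1]) (by linarith [ht.2, Real.pi_pos])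
    have hst : Real.sin t ≤ Real.sin b :=
      Real.sin_le_sin_of_le_of_le_pi_div_two (by linarith [ht.1, Real.pi_pos]) hb1 ht.2
    have hgt : 0 ≤ (chebDeriv n (j + 2)).eval (Real.cos t) := hg t (by linarith [ht.1]) ht.2
    have hst2 : (n : ℝ) ^ 2 * Real.sin t ^ 2 ≤ (n : ℝ) ^ 2 * Real.sin b ^ 2 := by gcongr
    have e1 : (n : ℝ) ^ 2 * Real.sin t ^ 2 * (1 - ε) ≤ K ^ 2 * (1 + ε) * (1 - ε) :=
      mul_le_mul_of_nonneg_right (by linarith) (by linarith)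
    have e2 : 0 ≤ ((j : ℝ) + 1) * (j + 2) - (n : ℝ) ^ 2 * Real.sin t ^ 2
        + n ^ 2 * ε * Real.sin t ^ 2 := by
      rw [show (j : ℝ) + 2 = K + 1 by linarith, hKj]
      nlinarith [mul_nonneg (sq_nonneg K) (sq_nonneg ε)]
    have e3 := mul_nonneg (mul_nonneg (pow_nonneg hs0 j) hgt) e2
    rw [chebLiouville, mul_pow, Real.sq_sqrt hε]
    refine e3.trans_eq ?_
    ring

/-! ### Gegenbauer values and their recurrence -/

/-- The Gegenbauer value `C_m^{(k+1)}(x)`, as a multiple of the `k`-th derivative of `U_{m+k}`. -/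
noncomputable def gegenbauerVal (x : ℝ) (k : ℕ) (m : ℤ) : ℝ :=
  (derivative^[k] (Polynomial.Chebyshev.U ℝ (m + k))).eval x / (k.factorial * 2 ^ k)

theorem iterate_derivative_U_recurrence (k : ℕ) (m : ℤ) :
    derivative^[k + 1] (Polynomial.Chebyshev.U ℝ (m + 2))
      = 2 * X * derivative^[k + 1] (Polynomial.Chebyshev.U ℝ (m + 1))
        + (2 * (k + 1) : ℝ[X]) * derivative^[k] (Polynomial.Chebyshev.U ℝ (m + 1))
        - derivative^[k + 1] (Polynomial.Chebyshev.U ℝ m) := by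
  have h2 : (2 : ℝ[X]) = C 2 := rfl
  rw [Polynomial.Chebyshev.U_add_two, iterate_derivative_sub, mul_assoc, h2,
    iterate_derivative_C_mul, mul_comm X, iterate_derivative_mul_X, ← h2, nsmul_eq_mul,
    Nat.add_sub_cancel]
  push_cast
  ring

/-- The coefficient form of `(1 - 2xz + z²) · (1 - 2xz + z²)^{-(k+2)} = (1 - 2xz + z²)^{-(k+1)}`.
Integer indices let the values at `-1` and `-2` serve as initial data. -/
theorem gegenbauerVal_recurrence (x : ℝ) (k : ℕ) (m : ℤ) :
    gegenbauerVal x (k + 1) m - 2 * x * gegenbauerVal x (k + 1) (m - 1)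
      + gegenbauerVal x (k + 1) (m - 2) = gegenbauerVal x k m := by
  have h := congrArg (eval x) (iterate_derivative_U_recurrence k (m + k - 1))
  simp only [eval_sub, eval_add, eval_mul, eval_X, eval_ofNat, eval_natCast, eval_one] at h
  simp only [gegenbauerVal]
  push_cast
  rw [show m + (k : ℤ) - 1 + 1 = m + k by ring] at h
  rw [show m + ((k : ℤ) + 1) = m + k - 1 + 2 by ring,
    show m - 1 + ((k : ℤ) + 1) = m + k by ring,
    show m - 2 + ((k : ℤ) + 1) = m + k - 1 by ring, h, Nat.factorial_succ]
  push_cast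
  have : (k.factorial : ℝ) ≠ 0 := by positivity
  field_simp
  ring

theorem gegenbauerVal_neg_one (x : ℝ) (k : ℕ) : gegenbauerVal x k (-1) = 0 := by
  unfold gegenbauerVal
  rcases k with _ | k
  · simp
  · rw [iterate_derivative_eq_zero]
    · simp
    · rw [show (-1 : ℤ) + ((k + 1 : ℕ) : ℤ) = (k : ℕ) by push_cast; ring,
        Polynomial.Chebyshev.natDegree_U_natCast]
      omega

/-- This fails at level `0`, where the value is `U_{-2} = -1`. -/
theorem gegenbauerVal_neg_two (x : ℝ) (k : ℕ) : gegenbauerVal x (k + 1) (-2) = 0 := by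
  unfold gegenbauerVal
  rcases k with _ | k
  · simp
  · rw [iterate_derivative_eq_zero]
    · simp
    · rw [show (-2 : ℤ) + ((k + 1 + 1 : ℕ) : ℤ) = (k : ℕ) by push_cast; ring,
        Polynomial.Chebyshev.natDegree_U_natCast]
      omega

theorem chebDeriv_eval_eq_gegenbauerVal {n k : ℕ} (x : ℝ) (h : k + 1 ≤ n) :
    (chebDeriv n (k + 1)).eval x
      = n * (k.factorial * 2 ^ k) * gegenbauerVal x k ((n - (k + 1) : ℕ) : ℤ) := by
  have h0 : (k.factorial : ℝ) ≠ 0 := by positivity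
  rw [gegenbauerVal, Nat.cast_sub h, mul_assoc, mul_div_cancel₀ _ (by positivity), chebDeriv,
    Function.iterate_succ_apply, Polynomial.Chebyshev.T_derivative_eq_U,
    iterate_derivative_intCast_mul]
  push_cast
  simp
  left
  congr 3
  ring

/-- Exhibits the minimum over a circle `|z| = R`: the last term is constant there, and the square
vanishes where `2 Re z = x(1 + R²)`, if such a point exists. -/
theorem normSq_generating (x : ℝ) (z : ℂ) :
    Complex.normSq (1 - 2 * x * z + z ^ 2)
      = (2 * z.re - x * (1 + Complex.normSq z)) ^ 2
        + (1 - Complex.normSq z) ^ 2 * (1 - x ^ 2) := by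
  simp [Complex.normSq_apply, pow_two]
  ring

theorem generating_ne_zero {x : ℝ} (hx : x ^ 2 < 1) {z : ℂ} (hz : ‖z‖ < 1) :
    1 - 2 * x * z + z ^ 2 ≠ 0 := by
  intro h0
  have h := normSq_generating x z
  rw [h0, map_zero, Complex.normSq_eq_norm_sq] at h
  have h1 : 0 < 1 - ‖z‖ ^ 2 := by nlinarith [norm_nonneg z]
  have : 0 < (1 - ‖z‖ ^ 2) ^ 2 * (1 - x ^ 2) := by
    have : 0 < 1 - x ^ 2 := by linarith
    positivity
  nlinarith [sq_nonneg (2 * z.re - x * (1 + ‖z‖ ^ 2))]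

/-! ### Contour integral representation -/

/-- The `m`-th Laurent coefficient of `(1 - 2 x z + z²)^{-k}` as a contour integral. -/
noncomputable def generatingIntegral (x R : ℝ) (k : ℕ) (m : ℤ) : ℂ :=
  (2 * Real.pi * Complex.I)⁻¹ *
    ∮ z in C(0, R), z ^ (-m - 1) * ((1 - 2 * x * z + z ^ 2) ^ k)⁻¹

theorem circleIntegrable_generating {x R : ℝ} (hx : x ^ 2 < 1) (hR : 0 < R) (hR1 : R < 1)
    (k : ℕ) (m : ℤ) :
    CircleIntegrable (fun z : ℂ => z ^ m * ((1 - 2 * x * z + z ^ 2) ^ k)⁻¹) 0 R := by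
  apply ContinuousOn.circleIntegrable hR.le
  intro z hz
  have hz' : ‖z‖ = R := by simpa using hz
  have hz0 : z ≠ 0 := by intro h; rw [h, norm_zero] at hz'; linarith
  apply ContinuousAt.continuousWithinAt
  apply ContinuousAt.mul
  · exact continuousAt_zpow₀ _ _ (Or.inl hz0)
  · apply ContinuousAt.inv₀
    · fun_prop
    · exact pow_ne_zero _ (generating_ne_zero hx (by linarith))

theorem generatingIntegral_recurrence {x R : ℝ} (hx : x ^ 2 < 1) (hR : 0 < R) (hR1 : R < 1)
    (k : ℕ) (m : ℤ) :
    generatingIntegral x R (k + 1) m - 2 * x * generatingIntegral x R (k + 1) (m - 1)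
      + generatingIntegral x R (k + 1) (m - 2) = generatingIntegral x R k m := by
  have hi := circleIntegrable_generating hx hR hR1 (k + 1)
  have key : (∮ z in C(0, R), z ^ (-m - 1) * ((1 - 2 * x * z + z ^ 2) ^ k)⁻¹)
      = (∮ z in C(0, R), z ^ (-m - 1) * ((1 - 2 * x * z + z ^ 2) ^ (k + 1))⁻¹)
        - (2 * x : ℂ) * (∮ z in C(0, R), z ^ (-(m - 1) - 1) * ((1 - 2 * x * z + z ^ 2) ^ (k + 1))⁻¹)
        + (∮ z in C(0, R), z ^ (-(m - 2) - 1) * ((1 - 2 * x * z + z ^ 2) ^ (k + 1))⁻¹) := by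
    rw [← circleIntegral.integral_const_mul, ← circleIntegral.integral_sub (hi _),
      ← circleIntegral.integral_add _ (hi _)]
    · apply circleIntegral.integral_congr hR.le
      intro z hz
      have hz' : ‖z‖ = R := by simpa using hz
      have hz0 : z ≠ 0 := by intro h; rw [h, norm_zero] at hz'; linarith
      have hne := generating_ne_zero hx (show ‖z‖ < 1 by linarith)
      simp only
      rw [show -(m - 1) - 1 = (-m - 1) + 1 by ring, show -(m - 2) - 1 = (-m - 1) + 1 + 1 by ring,
        zpow_add_one₀ hz0 (-m - 1 + 1), zpow_add_one₀ hz0 (-m - 1)]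
      generalize z ^ (-m - 1) = w
      have e : ((1 - 2 * x * z + z ^ 2) ^ k)⁻¹
          = (1 - 2 * x * z + z ^ 2) * ((1 - 2 * x * z + z ^ 2) ^ (k + 1))⁻¹ := by
        rw [pow_succ _ k, mul_inv, mul_left_comm, mul_inv_cancel₀ hne, mul_one]
      rw [e]
      ring
    · exact (hi _).sub ((hi _).const_smul (a := (2 * x : ℂ)))
    · exact (hi _).const_smul (a := (2 * x : ℂ))
  simp only [generatingIntegral]
  rw [key]
  ring

theorem generatingIntegral_of_neg {x R : ℝ} (hx : x ^ 2 < 1) (hR : 0 < R) (hR1 : R < 1)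
    (k : ℕ) (j : ℕ) : generatingIntegral x R k (-(j : ℤ) - 1) = 0 := by
  rw [generatingIntegral, mul_eq_zero]
  right
  have hd : DifferentiableOn ℂ (fun z : ℂ => z ^ (-(-(j : ℤ) - 1) - 1) *
      ((1 - 2 * x * z + z ^ 2) ^ k)⁻¹) (Metric.closedBall 0 R) := by
    intro z hz
    have hz' : ‖z‖ ≤ R := by simpa using hz
    have hne := pow_ne_zero k (generating_ne_zero hx (show ‖z‖ < 1 by linarith))
    have e : (-(-(j : ℤ) - 1) - 1) = (j : ℤ) := by ring
    simp only [e, zpow_natCast]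
    apply DifferentiableAt.differentiableWithinAt
    apply DifferentiableAt.mul (by fun_prop)
    exact DifferentiableAt.inv (by fun_prop) hne
  exact (hd.diffContOnCl_ball subset_rfl).circleIntegral_eq_zero hR.le

theorem generatingIntegral_zero {R : ℝ} (x : ℝ) (hR : 0 < R) (m : ℤ) :
    generatingIntegral x R 0 m = if m = 0 then 1 else 0 := by
  have h2 : (2 * Real.pi * Complex.I : ℂ) ≠ 0 := by simp
  simp only [generatingIntegral, pow_zero, inv_one, mul_one]
  split_ifs with h
  · have := circleIntegral.integral_sub_center_inv (0 : ℂ) hR.ne'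
    simp only [sub_zero] at this
    simp only [h, neg_zero, zero_sub, zpow_neg_one]
    rw [this, inv_mul_cancel₀ h2]
  · have := circleIntegral.integral_sub_zpow_of_ne (n := -m - 1) (by omega) (0 : ℂ) 0 R
    simp only [sub_zero] at this
    rw [this, mul_zero]

/-- No power series is expanded: the integrals obey the recurrence linking powers `k` and `k + 1`
and vanish at negative indices, which determines them by a double induction from the power `0`. -/
theorem generatingIntegral_eq_gegenbauerVal {x R : ℝ} (hx : x ^ 2 < 1) (hR : 0 < R) (hR1 : R < 1)
    (k : ℕ) (N : ℕ) : generatingIntegral x R (k + 1) N = gegenbauerVal x k N := by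
  have hm1 : ∀ k, generatingIntegral x R k (-1) = 0 := fun k => by
    simpa using generatingIntegral_of_neg hx hR hR1 k 0
  have hm2 : ∀ k, generatingIntegral x R k (-2) = 0 := fun k => by
    simpa using generatingIntegral_of_neg hx hR hR1 k 1
  have hrec := generatingIntegral_recurrence hx hR hR1
  induction k generalizing N with
  | zero =>
    induction N using Nat.twoStepInduction with
    | zero =>
      have := hrec 0 0
      rw [generatingIntegral_zero x hR] at this
      simp [hm1, hm2] at this
      simp [this, gegenbauerVal]
    | one =>
      have h0 := hrec 0 0
      have h1 := hrec 0 1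
      rw [generatingIntegral_zero x hR] at h0 h1
      simp [hm1, hm2] at h0 h1
      rw [h0] at h1
      simp [gegenbauerVal]
      linear_combination h1
    | more N ih0 ih1 =>
      have h := hrec 0 (N + 2 : ℕ)
      rw [generatingIntegral_zero x hR, if_neg (by positivity)] at h
      push_cast at h ih1 ⊢
      rw [show (N : ℤ) + 2 - 1 = N + 1 by ring, show (N : ℤ) + 2 - 2 = N by ring, ih0, ih1] at h
      have hU := congrArg (eval x) (Polynomial.Chebyshev.U_add_two ℝ (N : ℤ))
      simp only [eval_sub, eval_mul, eval_ofNat, eval_X] at hU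
      simp only [gegenbauerVal, Function.iterate_zero, id, Nat.cast_zero, add_zero, pow_zero,
        Nat.factorial_zero, Nat.cast_one, mul_one, div_one] at h ⊢
      rw [hU, Complex.ofReal_sub, Complex.ofReal_mul, Complex.ofReal_mul, Complex.ofReal_ofNat]
      linear_combination h
  | succ k ih =>
    have hg := gegenbauerVal_recurrence x k
    have hg' : ∀ m, (gegenbauerVal x (k + 1) m : ℂ) - 2 * x * gegenbauerVal x (k + 1) (m - 1)
      + gegenbauerVal x (k + 1) (m - 2) = gegenbauerVal x k m := fun m => by exact_mod_cast hg m
    induction N using Nat.twoStepInduction with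
    | zero =>
      have h := hrec (k + 1) (0 : ℕ)
      have h' := hg' (0 : ℕ)
      rw [ih] at h
      simp [hm1, hm2, gegenbauerVal_neg_one, gegenbauerVal_neg_two] at h h' ⊢
      rw [h, h']
    | one =>
      have h0 := hrec (k + 1) (0 : ℕ)
      have h0' := hg' (0 : ℕ)
      have h := hrec (k + 1) (1 : ℕ)
      have h' := hg' (1 : ℕ)
      rw [ih] at h h0
      simp [hm1, hm2, gegenbauerVal_neg_one, gegenbauerVal_neg_two] at h h' h0 h0' ⊢
      rw [← h0'] at h0
      linear_combination h - h' + 2 * x * h0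
    | more N ih0 ih1 =>
      have h := hrec (k + 1) (N + 2 : ℕ)
      have h' := hg' (N + 2 : ℕ)
      rw [ih] at h
      push_cast at h h' ih1 ⊢
      rw [show (N : ℤ) + 2 - 1 = N + 1 by ring, show (N : ℤ) + 2 - 2 = N by ring] at h h'
      rw [ih0, ih1] at h
      linear_combination h - h'

theorem norm_generatingIntegral_le (x : ℝ) {R : ℝ} (hR : 0 < R) (k N : ℕ) :
    ‖generatingIntegral x R k N‖ ≤ (2 * Real.pi)⁻¹ * (R⁻¹ ^ N *
      ∫ t in (0 : ℝ)..2 * Real.pi,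
        (√((2 * R * Real.cos t - x * (1 + R ^ 2)) ^ 2 + (1 - R ^ 2) ^ 2 * (1 - x ^ 2)) ^ k)⁻¹) := by
  rw [generatingIntegral, norm_mul]
  have h2 : ‖(2 * Real.pi * Complex.I : ℂ)⁻¹‖ = (2 * Real.pi)⁻¹ := by
    simp [abs_of_pos Real.pi_pos]
  rw [h2]
  gcongr
  rw [circleIntegral, ← intervalIntegral.integral_const_mul]
  refine (intervalIntegral.norm_integral_le_integral_norm (by positivity)).trans_eq ?_
  apply intervalIntegral.integral_congr
  intro t _
  have hns : Complex.normSq (circleMap 0 R t) = R ^ 2 := by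
    rw [Complex.normSq_eq_norm_sq, norm_circleMap_zero, sq_abs]
  have hre : (circleMap 0 R t).re = R * Real.cos t := by
    simp [circleMap, Complex.exp_re]
  have hns2 := normSq_generating x (circleMap 0 R t)
  rw [hns, hre, Complex.normSq_eq_norm_sq] at hns2
  have hnorm : ‖(1 - 2 * x * circleMap 0 R t + circleMap 0 R t ^ 2 : ℂ)‖
      = √((2 * R * Real.cos t - x * (1 + R ^ 2)) ^ 2 + (1 - R ^ 2) ^ 2 * (1 - x ^ 2)) := by
    rw [← Real.sqrt_sq (norm_nonneg _), hns2]
    ring_nf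
  simp only [smul_eq_mul, norm_mul, norm_zpow, norm_inv, norm_pow, hnorm, deriv_circleMap,
    norm_circleMap_zero, Complex.norm_I, mul_one, abs_of_pos hR]
  rw [← mul_assoc]
  congr 1
  rw [show -(N : ℤ) - 1 = -(N : ℤ) + -1 by ring, zpow_add₀ hR.ne', zpow_neg, zpow_natCast,
    zpow_neg_one, inv_pow]
  field_simp

/-! ### Cauchy estimates on the circle -/

theorem integral_inv_add_mul_sq_le {d K : ℝ} (hd : 0 < d) (hK : 0 < K) (c : ℝ) {a b : ℝ} :
    ∫ t in a..b, (d + K * (t - c) ^ 2)⁻¹ ≤ Real.pi / √(d * K) := by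
  have hs : 0 < √(d * K) := Real.sqrt_pos.mpr (by positivity)
  have hs2 : √(d * K) ^ 2 = d * K := Real.sq_sqrt (by positivity)
  have hder : ∀ t ∈ Set.uIcc a b, HasDerivAt
      (fun t => Real.arctan (√(d * K) / d * (t - c)) / √(d * K)) ((d + K * (t - c) ^ 2)⁻¹) t := by
    intro t _
    have h1 : HasDerivAt (fun t => √(d * K) / d * (t - c)) (√(d * K) / d) t := by
      simpa using ((hasDerivAt_id t).sub_const c).const_mul (√(d * K) / d)
    refine (h1.arctan.div_const _).congr_deriv ?_
    have : 0 < d + K * (t - c) ^ 2 := by positivity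
    rw [mul_pow, div_pow, hs2]
    field_simp
  rw [intervalIntegral.integral_eq_sub_of_hasDerivAt hder]
  · rw [← sub_div]
    gcongr
    have h1 := Real.arctan_lt_pi_div_two (√(d * K) / d * (b - c))
    have h2 := Real.neg_pi_div_two_lt_arctan (√(d * K) / d * (a - c))
    linarith
  · apply Continuous.intervalIntegrable
    apply Continuous.inv₀ (by fun_prop)
    intro t
    positivity

/-- With `A = 1 - cos t cos s` and `B = sin t sin s ≥ 0`, one has `(cos t - cos s)² = A² - B² ≥ (A -
B)²` and `A - B = 1 - cos(t - s)`. A quadratic bound is the best that is uniform in `s`, since at `s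
= 0` the zero is double. -/
theorem mul_sq_le_abs_cos_sub_cos {s t : ℝ} (hs : s ∈ Set.Icc 0 Real.pi)
    (ht : t ∈ Set.Icc 0 Real.pi) :
    2 / Real.pi ^ 2 * (t - s) ^ 2 ≤ |Real.cos t - Real.cos s| := by
  have h1 : 1 - Real.cos (t - s) ≤ |Real.cos t - Real.cos s| := by
    have hss := Real.sin_nonneg_of_mem_Icc hs
    have hst := Real.sin_nonneg_of_mem_Icc ht
    have e1 := Real.sin_sq_add_cos_sq s
    have e2 := Real.sin_sq_add_cos_sq t
    have hc : Real.cos (t - s) ≤ 1 := Real.cos_le_one _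
    have ha : Real.cos (t - s) = Real.cos t * Real.cos s + Real.sin t * Real.sin s :=
      Real.cos_sub t s
    apply abs_le_of_sq_le_sq' _ (abs_nonneg _) |>.2
    rw [sq_abs, ha]
    have e3 : (1 - Real.cos t * Real.cos s) ^ 2
        = (Real.cos t - Real.cos s) ^ 2 + (Real.sin t * Real.sin s) ^ 2 := by
      rw [mul_pow]
      linear_combination -Real.sin s ^ 2 * e2 - (1 - Real.cos t ^ 2) * e1
    nlinarith [mul_nonneg hst hss]
  have h2 := Real.cos_le_one_sub_mul_cos_sq (x := t - s)
    (abs_le.mpr ⟨by linarith [hs.2, ht.1], by linarith [hs.1, ht.2]⟩)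
  linarith

theorem inv_sqrt_sq_add_sq_le {u d m : ℝ} (hd : 0 < d) (hm : 0 ≤ m) (hu : m ≤ |u|) :
    (√(u ^ 2 + d ^ 2))⁻¹ ≤ √2 * (d + m)⁻¹ := by
  rw [← div_eq_mul_inv, ← one_div, div_le_div_iff₀ (by positivity) (by positivity), one_mul,
    ← Real.sqrt_mul (by norm_num)]
  apply Real.le_sqrt_of_sq_le
  have : m ^ 2 ≤ u ^ 2 := by rw [← sq_abs u]; gcongr
  nlinarith [sq_nonneg (d - m)]

/-- The integrand peaks at the two zeros `arccos c` and `2π - arccos c` of `cos t - c`. Each peak is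
dominated by a function `(d + K(t - e)²)⁻¹`, whose integral is at most `π/√(dK)`, uniformly in `c`
up to `1`. -/
theorem integral_inv_sqrt_cos_le {R d c : ℝ} (hR : 0 < R) (hd : 0 < d) (hc : 0 ≤ c)
    (hc1 : c ≤ 1) :
    ∫ t in (0 : ℝ)..2 * Real.pi, (√((2 * R * (Real.cos t - c)) ^ 2 + d ^ 2))⁻¹
      ≤ √2 * Real.pi ^ 2 / √(d * R) := by
  have hpi := Real.pi_pos
  set s := Real.arccos c with hs
  have hcs : Real.cos s = c := Real.cos_arccos (by linarith) hc1
  have hsI : s ∈ Set.Icc 0 Real.pi := ⟨Real.arccos_nonneg c, Real.arccos_le_pi c⟩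
  set K : ℝ := 4 * R / Real.pi ^ 2 with hK
  have hK0 : 0 < K := by positivity
  have hcont : ∀ e, Continuous fun t : ℝ => (d + K * (t - e) ^ 2)⁻¹ := by
    intro e
    apply Continuous.inv₀ (by fun_prop)
    intro t
    positivity
  have hpt : ∀ t ∈ Set.Icc 0 (2 * Real.pi),
      (√((2 * R * (Real.cos t - c)) ^ 2 + d ^ 2))⁻¹
        ≤ √2 * ((d + K * (t - s) ^ 2)⁻¹ + (d + K * (t - (2 * Real.pi - s)) ^ 2)⁻¹) := by
    intro t ht
    have habs : |2 * R * (Real.cos t - c)| = 2 * R * |Real.cos t - Real.cos s| := by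
      rw [abs_mul, abs_of_pos (by positivity), hcs]
    rcases le_total t Real.pi with h | h
    · have h1 := mul_sq_le_abs_cos_sub_cos hsI ⟨ht.1, h⟩
      have h2 : K * (t - s) ^ 2 ≤ |2 * R * (Real.cos t - c)| := by
        rw [habs]
        calc K * (t - s) ^ 2 = 2 * R * (2 / Real.pi ^ 2 * (t - s) ^ 2) := by rw [hK]; ring
          _ ≤ _ := by gcongr
      refine (inv_sqrt_sq_add_sq_le hd (by positivity) h2).trans ?_
      gcongr
      exact le_add_of_nonneg_right (by positivity)
    · have h1 := mul_sq_le_abs_cos_sub_cos hsI (t := 2 * Real.pi - t)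
        ⟨by linarith [ht.2], by linarith⟩
      rw [Real.cos_two_pi_sub] at h1
      have h2 : K * (t - (2 * Real.pi - s)) ^ 2 ≤ |2 * R * (Real.cos t - c)| := by
        rw [habs]
        calc K * (t - (2 * Real.pi - s)) ^ 2
            = 2 * R * (2 / Real.pi ^ 2 * (2 * Real.pi - t - s) ^ 2) := by rw [hK]; ring
          _ ≤ _ := by gcongr
      refine (inv_sqrt_sq_add_sq_le hd (by positivity) h2).trans ?_
      gcongr
      exact le_add_of_nonneg_left (by positivity)
  have hmono := intervalIntegral.integral_mono_on (μ := MeasureTheory.volume)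
    (by positivity : (0 : ℝ) ≤ 2 * Real.pi)
    (Continuous.intervalIntegrable (by
      apply Continuous.inv₀ (by fun_prop)
      intro t
      positivity) _ _)
    (g := fun t => √2 * ((d + K * (t - s) ^ 2)⁻¹ + (d + K * (t - (2 * Real.pi - s)) ^ 2)⁻¹))
    (((hcont s).add (hcont (2 * Real.pi - s))).const_mul (√2) |>.intervalIntegrable _ _) hpt
  refine hmono.trans ?_
  rw [intervalIntegral.integral_const_mul, intervalIntegral.integral_add
    ((hcont _).intervalIntegrable _ _) ((hcont _).intervalIntegrable _ _)]
  have h1 := integral_inv_add_mul_sq_le hd hK0 s (a := 0) (b := 2 * Real.pi)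
  have h2 := integral_inv_add_mul_sq_le hd hK0 (2 * Real.pi - s) (a := 0) (b := 2 * Real.pi)
  have h3 : √(d * K) = 2 * √(d * R) / Real.pi := by
    rw [Real.sqrt_eq_iff_eq_sq (by positivity) (by positivity), div_pow, mul_pow,
      Real.sq_sqrt (by positivity), hK]
    ring
  rw [h3] at h1 h2
  have hsq : 0 < √(d * R) := Real.sqrt_pos.mpr (by positivity)
  calc _ ≤ √2 * (Real.pi / (2 * √(d * R) / Real.pi) + Real.pi / (2 * √(d * R) / Real.pi)) := by
        gcongr
    _ = _ := by field_simp; ring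

/-- Cauchy estimate for Gegenbauer values on a circle of radius `R`: the modulus of `1 - 2 x z + z²`
there is at least `(1 - R²) √(1 - x²)`. -/
theorem abs_gegenbauerVal_le {x R : ℝ} (hx1 : x ^ 2 < 1) (hR : 0 < R) (hR1 : R < 1) (k N : ℕ) :
    |gegenbauerVal x k N| ≤ R⁻¹ ^ N * (((1 - R ^ 2) * √(1 - x ^ 2)) ^ (k + 1))⁻¹ := by
  have hpi := Real.pi_pos
  have hd : 0 < (1 - R ^ 2) * √(1 - x ^ 2) := by
    have : 0 < 1 - R ^ 2 := by nlinarith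
    have : 0 < √(1 - x ^ 2) := Real.sqrt_pos.mpr (by linarith)
    positivity
  set d := (1 - R ^ 2) * √(1 - x ^ 2) with hdd
  have hd2 : d ^ 2 = (1 - R ^ 2) ^ 2 * (1 - x ^ 2) := by
    rw [hdd, mul_pow, Real.sq_sqrt (by linarith)]
  have h := norm_generatingIntegral_le x hR (k + 1) N
  rw [generatingIntegral_eq_gegenbauerVal hx1 hR hR1, Complex.norm_real, Real.norm_eq_abs,
    ← hd2] at h
  refine h.trans ?_
  have hint : ∫ t in (0 : ℝ)..2 * Real.pi,
        (√((2 * R * Real.cos t - x * (1 + R ^ 2)) ^ 2 + d ^ 2) ^ (k + 1))⁻¹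
      ≤ ∫ t in (0 : ℝ)..2 * Real.pi, (d ^ (k + 1))⁻¹ := by
    apply intervalIntegral.integral_mono_on (by positivity)
    · apply Continuous.intervalIntegrable
      apply Continuous.inv₀ (by fun_prop)
      intro t
      positivity
    · exact intervalIntegrable_const
    · intro t _
      gcongr
      apply Real.le_sqrt_of_sq_le
      nlinarith [sq_nonneg (2 * R * Real.cos t - x * (1 + R ^ 2))]
  rw [intervalIntegral.integral_const, sub_zero, smul_eq_mul] at hint
  calc _ ≤ (2 * Real.pi)⁻¹ * (R⁻¹ ^ N * (2 * Real.pi * (d ^ (k + 1))⁻¹)) := by gcongr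
    _ = _ := by field_simp

/-- Refinement of `abs_gegenbauerVal_le` that takes the width of the minimum into account. -/
theorem abs_gegenbauerVal_le_sqrt {x R : ℝ} (hx : 0 ≤ x) (hx1 : x ^ 2 < 1) (hR : 0 < R)
    (hR1 : R < 1) (hxR : x * (1 + R ^ 2) ≤ 2 * R) (k N : ℕ) :
    |gegenbauerVal x k N| ≤ 3 * (R⁻¹ ^ N * (((1 - R ^ 2) * √(1 - x ^ 2)) ^ k)⁻¹
      * (√((1 - R ^ 2) * √(1 - x ^ 2) * R))⁻¹) := by
  have hpi := Real.pi_pos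
  have hd : 0 < (1 - R ^ 2) * √(1 - x ^ 2) := by
    have : 0 < 1 - R ^ 2 := by nlinarith
    have : 0 < √(1 - x ^ 2) := Real.sqrt_pos.mpr (by linarith)
    positivity
  set d := (1 - R ^ 2) * √(1 - x ^ 2) with hdd
  have hd2 : d ^ 2 = (1 - R ^ 2) ^ 2 * (1 - x ^ 2) := by
    rw [hdd, mul_pow, Real.sq_sqrt (by linarith)]
  have h := norm_generatingIntegral_le x hR (k + 1) N
  rw [generatingIntegral_eq_gegenbauerVal hx1 hR hR1, Complex.norm_real, Real.norm_eq_abs,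
    ← hd2] at h
  refine h.trans ?_
  set c := x * (1 + R ^ 2) / (2 * R) with hc
  have hcR : ∀ t, 2 * R * Real.cos t - x * (1 + R ^ 2) = 2 * R * (Real.cos t - c) := by
    intro t; rw [hc]; field_simp
  have hint : ∫ t in (0 : ℝ)..2 * Real.pi,
        (√((2 * R * Real.cos t - x * (1 + R ^ 2)) ^ 2 + d ^ 2) ^ (k + 1))⁻¹
      ≤ ∫ t in (0 : ℝ)..2 * Real.pi,
        (d ^ k)⁻¹ * (√((2 * R * (Real.cos t - c)) ^ 2 + d ^ 2))⁻¹ := by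
    apply intervalIntegral.integral_mono_on (by positivity)
    · apply Continuous.intervalIntegrable
      apply Continuous.inv₀ (by fun_prop)
      intro t
      positivity
    · apply Continuous.intervalIntegrable
      apply Continuous.mul (by fun_prop)
      apply Continuous.inv₀ (by fun_prop)
      intro t
      positivity
    -- Of the `k + 1` factors, `k` are bounded by the minimum `d` and one is kept under the
    -- integral.
    · intro t _
      rw [hcR, pow_succ, mul_inv]
      gcongr
      apply Real.le_sqrt_of_sq_le
      nlinarith [sq_nonneg (2 * R * (Real.cos t - c))]
  rw [intervalIntegral.integral_const_mul] at hint
  have hI := integral_inv_sqrt_cos_le hR hd (c := c) (by positivity)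
    (by rw [hc, div_le_one (by positivity)]; exact hxR)
  have hs2 : √2 ≤ 3 / 2 := by
    rw [Real.sqrt_le_left (by norm_num)]; norm_num
  have hsq : 0 < √(d * R) := Real.sqrt_pos.mpr (by positivity)
  calc _ ≤ (2 * Real.pi)⁻¹ * (R⁻¹ ^ N * ((d ^ k)⁻¹ * (√2 * Real.pi ^ 2 / √(d * R)))) := by
        gcongr
        exact hint.trans (by gcongr)
    _ = (√2 * Real.pi / 2) * (R⁻¹ ^ N * (d ^ k)⁻¹ * (√(d * R))⁻¹) := by field_simp
    _ ≤ _ := by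
        gcongr
        nlinarith [Real.pi_lt_d2, Real.sqrt_nonneg 2]

/-! ### The value at 1 and Stirling bounds -/

theorem chebDeriv_succ_eval_one (j m : ℕ) :
    (chebDeriv (m + j + 1) (j + 1)).eval 1 * (2 * j + 1).factorial * m.factorial
      = ((m + j + 1 : ℕ) : ℝ) * j.factorial * 2 ^ j * (m + 2 * j + 1).factorial := by
  induction j generalizing m with
  | zero =>
    have h := Polynomial.Chebyshev.derivative_T_eval_one (R := ℝ) ((m + 1 : ℕ) : ℤ)
    simp only [chebDeriv, Nat.factorial_succ]
    simp at h ⊢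
    rw [h]
    ring
  | succ j ih =>
    have hrec := Polynomial.Chebyshev.iterate_derivative_T_eval_one_recurrence (R := ℝ)
      ((m + 1 + j + 1 : ℕ) : ℤ) (j + 1)
    -- The degree stays fixed while the order of differentiation grows, so `m` drops by one.
    have h := ih (m + 1)
    change (2 * ((j + 1 : ℕ) : ℝ) + 1) * (chebDeriv (m + 1 + j + 1) (j + 1 + 1)).eval 1
      = _ * (chebDeriv (m + 1 + j + 1) (j + 1)).eval 1 at hrec
    rw [show m + (j + 1) + 1 = m + 1 + j + 1 by ring,
      show 2 * (j + 1) + 1 = 2 * j + 1 + 1 + 1 by ring,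
      show m + 2 * (j + 1) + 1 = m + 1 + 2 * j + 1 + 1 by ring,
      Nat.factorial_succ (2 * j + 1 + 1), Nat.factorial_succ (2 * j + 1),
      Nat.factorial_succ (m + 1 + 2 * j + 1), Nat.factorial_succ j]
    rw [Nat.factorial_succ m] at h
    push_cast at h hrec ⊢
    have hm : (m : ℝ) + 1 ≠ 0 := by positivity
    apply mul_left_cancel₀ hm
    linear_combination (2 * (j : ℝ) + 2) * (m + 2 * j + 3) * (m + 1) * h
      + (2 * (j : ℝ) + 2) * (2 * j + 1).factorial * m.factorial * (m + 1) * hrec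

/-- That is, the value at `1` is the binomial coefficient of `m + 2j + 1` over `m`. -/
theorem gegenbauerVal_one (j m : ℕ) :
    gegenbauerVal 1 j m * ((2 * j + 1).factorial * m.factorial) = (m + 2 * j + 1).factorial := by
  have h := chebDeriv_succ_eval_one j m
  rw [chebDeriv_eval_eq_gegenbauerVal 1 (by omega), show m + j + 1 - (j + 1) = m by omega] at h
  have h0 : ((m + j + 1 : ℕ) : ℝ) * (j.factorial * 2 ^ j) ≠ 0 := by positivity
  apply mul_left_cancel₀ h0
  linear_combination h

theorem gegenbauerVal_one_pos (j m : ℕ) : 0 < gegenbauerVal 1 j m := by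
  have : 0 < gegenbauerVal 1 j m * ((2 * j + 1).factorial * m.factorial : ℝ) := by
    rw [gegenbauerVal_one]; positivity
  exact pos_of_mul_pos_left this (by positivity)

/-- The Stirling sequence decreases from its first term `e/√2`. -/
theorem factorial_le_exp_mul_sqrt {m : ℕ} (hm : 1 ≤ m) :
    (m.factorial : ℝ) ≤ Real.exp 1 * √m * (m / Real.exp 1) ^ m := by
  obtain ⟨l, rfl⟩ : ∃ l, m = l + 1 := ⟨m - 1, by omega⟩
  have h := Stirling.stirlingSeq'_antitone (Nat.zero_le l)
  simp only [Function.comp, Nat.succ_eq_add_one, zero_add, Stirling.stirlingSeq_one] at h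
  rw [Stirling.stirlingSeq, div_le_iff₀ (by positivity)] at h
  refine h.trans_eq ?_
  rw [Real.sqrt_mul (by norm_num)]
  have : √2 ≠ 0 := by positivity
  field_simp

/-- Stirling bound for the reciprocal of a binomial coefficient. -/
theorem factorial_mul_factorial_le {a b : ℕ} (ha : 1 ≤ a) (hb : 1 ≤ b) :
    (a.factorial : ℝ) * b.factorial
      ≤ 4 * √(a * b / (a + b)) * (a / (a + b)) ^ a * (b / (a + b)) ^ b * (a + b).factorial := by
  have h1 := factorial_le_exp_mul_sqrt ha
  have h2 := factorial_le_exp_mul_sqrt hb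
  have h3 := Stirling.le_factorial_stirling (a + b)
  have ha0 : (0 : ℝ) < a := by exact_mod_cast ha
  have hb0 : (0 : ℝ) < b := by exact_mod_cast hb
  have he := Real.exp_pos 1
  push_cast at h3
  set e := Real.exp 1 with hedef
  have hM : 0 < √((a : ℝ) + b) := Real.sqrt_pos.mpr (by positivity)
  have hpi : e ^ 2 ≤ 4 * √(2 * Real.pi) := by
    have h5 : e ≤ 2.72 := by linarith [Real.exp_one_lt_d9]
    have h6 : 2 ≤ √(2 * Real.pi) := by
      apply Real.le_sqrt_of_sq_le; nlinarith [Real.pi_gt_three]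
    nlinarith
  calc (a.factorial : ℝ) * b.factorial
      ≤ (e * √a * (a / e) ^ a) * (e * √b * (b / e) ^ b) := by gcongr
    _ = e ^ 2 * (√(a * b / (a + b)) * (a / (a + b)) ^ a * (b / (a + b)) ^ b
          * (√(a + b) * ((a + b) / e) ^ (a + b))) := by
        rw [Real.sqrt_div (by positivity), Real.sqrt_mul ha0.le]
        simp only [div_pow, pow_add]
        field_simp
    _ ≤ (4 * √(2 * Real.pi)) * (√(a * b / (a + b)) * (a / (a + b)) ^ a * (b / (a + b)) ^ b
          * (√(a + b) * ((a + b) / e) ^ (a + b))) := by gcongr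
    _ = 4 * √(a * b / (a + b)) * (a / (a + b)) ^ a * (b / (a + b)) ^ b
          * (√(2 * Real.pi * (a + b)) * ((a + b) / e) ^ (a + b)) := by
        rw [Real.sqrt_mul (by positivity) ((a : ℝ) + b)]; ring
    _ ≤ _ := by gcongr

/-- Stirling is applied to `N` and `2(j+1)` in place of `2j+1`, so that the powers match those of
the Cauchy estimate; the extra factor `(N + b)/b`, `b = 2(j+1)`, goes into the square root. -/
theorem inv_gegenbauerVal_one_le {j N : ℕ} (hN : 1 ≤ N) :
    (gegenbauerVal 1 j N)⁻¹ ≤ 4 * √(N * (N + 2 * (j + 1)) / (2 * (j + 1)))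
      * (N / (N + 2 * (j + 1))) ^ N * ((2 * (j + 1)) / (N + 2 * (j + 1))) ^ (2 * (j + 1)) := by
  have h := factorial_mul_factorial_le hN (show 1 ≤ 2 * (j + 1) by omega)
  have hg := gegenbauerVal_one j N
  have hN0 : (0 : ℝ) < N := by exact_mod_cast hN
  rw [show N + 2 * (j + 1) = (N + 2 * j + 1) + 1 by ring, Nat.factorial_succ (N + 2 * j + 1),
    show 2 * (j + 1) = (2 * j + 1) + 1 by ring, Nat.factorial_succ (2 * j + 1)] at h
  rw [← show 2 * (j + 1) = (2 * j + 1) + 1 by ring] at h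
  push_cast at h
  rw [← hg] at h
  set b : ℝ := 2 * ((j : ℝ) + 1) with hb
  have hb0 : 0 < b := by positivity
  rw [show (N : ℝ) + 2 * j + 1 + 1 = N + b by rw [hb]; ring] at h
  have hG := gegenbauerVal_one_pos j N
  rw [inv_le_iff_one_le_mul₀ hG]
  have hP : (0 : ℝ) < b * ((2 * j + 1).factorial * N.factorial) := by positivity
  apply le_of_mul_le_mul_left _ hP
  have hsq : √(N * (N + b) / b) = √(N * b / (N + b)) * ((N + b) / b) := by
    rw [← Real.sqrt_sq (show 0 ≤ (N + b) / b by positivity), ← Real.sqrt_mul (by positivity)]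
    congr 1
    field_simp
  rw [hsq]
  have e1 : b * (((2 * j + 1).factorial : ℝ) * N.factorial) * 1
    = N.factorial * (b * (2 * j + 1).factorial) := by ring
  rw [e1]
  refine h.trans_eq ?_
  field_simp

/-! ### Bounds for τ in terms of the rate -/

theorem chebTau_eq_gegenbauerVal {j N : ℕ} :
    chebTau (N + j + 1) (j + 1) = |gegenbauerVal (rightmostZero (N + j + 1) (j + 1)) j N|
      * (gegenbauerVal 1 j N)⁻¹ := by
  rw [chebTau, chebDeriv_eval_eq_gegenbauerVal _ (by omega),
    chebDeriv_eval_eq_gegenbauerVal _ (by omega), show N + j + 1 - (j + 1) = N by omega, abs_mul,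
    abs_of_pos (by positivity), mul_div_mul_left _ _ (by positivity), div_eq_mul_inv]

theorem sqrt_one_sub_rightmostZero_pos {n k : ℕ} (h : k + 2 ≤ n) :
    0 < √(1 - rightmostZero n k ^ 2) := by
  apply Real.sqrt_pos.mpr
  nlinarith [rightmostZero_nonneg h, rightmostZero_lt_one h]

theorem le_mul_sqrt_one_sub_rightmostZero {n k : ℕ} (hk : 1 ≤ k) (h : k + 2 ≤ n) :
    (k : ℝ) ≤ n * √(1 - rightmostZero n k ^ 2) := by
  have h1 := mul_succ_lt_of_rightmostZero hk h
  have hs := sqrt_one_sub_rightmostZero_pos h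
  refine (sq_le_sq₀ (by positivity) (by positivity)).mp ?_
  rw [mul_pow, Real.sq_sqrt (Real.sqrt_pos.mp hs).le]
  have : (0 : ℝ) ≤ k := by positivity
  linarith

theorem chebTau_le {n k : ℕ} (hk : 1 ≤ k) (h : k + 2 ≤ n) :
    chebTau n k ≤ 4 * √(((n : ℝ) - k) * (n + k) / (2 * k)) * √(((n : ℝ) - k) / (n + k)) ^ (n - k)
      * (2 * k / ((n + k) * √(1 - rightmostZero n k ^ 2))) ^ k := by
  have hs := sqrt_one_sub_rightmostZero_pos h
  have hs' := Real.sqrt_pos.mp hs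
  obtain ⟨j, rfl⟩ : ∃ j, k = j + 1 := ⟨k - 1, by omega⟩
  obtain ⟨N, rfl⟩ : ∃ N, n = N + j + 1 := ⟨n - j - 1, by omega⟩
  have hN : 1 ≤ N := by omega
  rw [chebTau_eq_gegenbauerVal]
  generalize rightmostZero (N + j + 1) (j + 1) = x at *
  have hG0 : 0 ≤ (gegenbauerVal 1 j N)⁻¹ := (inv_pos.mpr (gegenbauerVal_one_pos j N)).le
  have hG := inv_gegenbauerVal_one_le (j := j) hN
  rw [show N + j + 1 - (j + 1) = N by omega]
  push_cast
  have ha : (0 : ℝ) < N := by exact_mod_cast hN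
  rw [show (N : ℝ) + j + 1 - (j + 1) = N by ring,
    show (N : ℝ) + j + 1 + (j + 1) = N + 2 * (j + 1) by ring]
  have hb : (0 : ℝ) < 2 * (j + 1) := by positivity
  set b : ℝ := 2 * ((j : ℝ) + 1)
  -- This radius maximises `R^N (1 - R²)^{j+1}`, hence minimises the Cauchy bound.
  set R := √((N : ℝ) / (N + b)) with hR
  have hR2 : R ^ 2 = N / (N + b) := Real.sq_sqrt (by positivity)
  have hR0 : 0 < R := Real.sqrt_pos.mpr (by positivity)
  have hRb : 1 - R ^ 2 = b / (N + b) := by rw [hR2]; field_simp; ring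
  have hR1 : R < 1 := by
    have : 0 < 1 - R ^ 2 := by rw [hRb]; positivity
    nlinarith
  have hc := abs_gegenbauerVal_le (by linarith : x ^ 2 < 1) hR0 hR1 j N
  rw [hRb] at hc
  rw [← hR2, pow_mul] at hG
  set σ := √(1 - x ^ 2)
  set q := √((N : ℝ) * (N + b) / b)
  calc _ ≤ (R⁻¹ ^ N * ((b / (N + b) * σ) ^ (j + 1))⁻¹)
        * (4 * q * (R ^ 2) ^ N * ((b / (N + b)) ^ 2) ^ (j + 1)) := by gcongr
    _ = _ := by
      have e1 : R⁻¹ ^ N * (R ^ 2) ^ N = R ^ N := by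
        rw [← mul_pow]; congr 1; field_simp
      have e2 : ((b / (N + b) * σ) ^ (j + 1))⁻¹ * ((b / (N + b)) ^ 2) ^ (j + 1)
          = (b / ((N + b) * σ)) ^ (j + 1) := by
        rw [← inv_pow, ← mul_pow]; congr 1; field_simp
      rw [← e1, ← e2]
      ring

theorem chebTau_le_of_two_mul_le {n k : ℕ} (hk : 1 ≤ k) (h : k + 2 ≤ n) (hn : 2 * k ≤ n) :
    chebTau n k ≤ 24 * √(n * √(1 - rightmostZero n k ^ 2))
      * √(((n : ℝ) - k) / (n + k)) ^ (n - k)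
      * (2 * k / ((n + k) * √(1 - rightmostZero n k ^ 2))) ^ k := by
  have hs := sqrt_one_sub_rightmostZero_pos h
  have hs' := Real.sqrt_pos.mp hs
  have hx0 := rightmostZero_nonneg h
  have hturn := le_mul_sqrt_one_sub_rightmostZero hk h
  obtain ⟨j, rfl⟩ : ∃ j, k = j + 1 := ⟨k - 1, by omega⟩
  obtain ⟨N, rfl⟩ : ∃ N, n = N + j + 1 := ⟨n - j - 1, by omega⟩
  have hN : 1 ≤ N := by omega
  have hNj : j + 1 ≤ N := by omega
  rw [chebTau_eq_gegenbauerVal]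
  generalize rightmostZero (N + j + 1) (j + 1) = x at *
  have hG0 : 0 ≤ (gegenbauerVal 1 j N)⁻¹ := (inv_pos.mpr (gegenbauerVal_one_pos j N)).le
  have hG := inv_gegenbauerVal_one_le (j := j) hN
  rw [show N + j + 1 - (j + 1) = N by omega]
  push_cast at hturn ⊢
  have ha : (0 : ℝ) < N := by exact_mod_cast hN
  have hNj' : (j : ℝ) + 1 ≤ N := by exact_mod_cast hNj
  rw [show (N : ℝ) + j + 1 - (j + 1) = N by ring,
    show (N : ℝ) + j + 1 + (j + 1) = N + 2 * (j + 1) by ring]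
  have hb : (0 : ℝ) < 2 * (j + 1) := by positivity
  have hn' : (N : ℝ) + j + 1 = N + (2 * (j + 1)) / 2 := by ring
  have hk' : (j : ℝ) + 1 = (2 * (j + 1)) / 2 := by ring
  rw [hn', hk'] at hturn
  rw [hk'] at hNj'
  rw [hn']
  set b : ℝ := 2 * ((j : ℝ) + 1)
  set R := √((N : ℝ) / (N + b)) with hR
  have hR2 : R ^ 2 = N / (N + b) := Real.sq_sqrt (by positivity)
  have hR0 : 0 < R := Real.sqrt_pos.mpr (by positivity)
  have hRb : 1 - R ^ 2 = b / (N + b) := by rw [hR2]; field_simp; ring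
  have hR1 : R < 1 := by
    have : 0 < 1 - R ^ 2 := by rw [hRb]; positivity
    nlinarith
  have hRhalf : 1 / 2 ≤ R := by
    apply Real.le_sqrt_of_sq_le
    rw [le_div_iff₀ (by positivity)]
    linarith
  have hsq : √(1 - x ^ 2) ^ 2 = 1 - x ^ 2 := Real.sq_sqrt hs'.le
  -- For this `R` the inequality is equivalent to `k ≤ n√(1 - x²)`, the turning point bound: the
  -- minimum of the modulus is attained on the circle.
  have hxR : x * (1 + R ^ 2) ≤ 2 * R := by
    refine (sq_le_sq₀ (by positivity) (by positivity)).mp ?_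
    have hturn' : b / 2 ≤ (N + b / 2) * √(1 - x ^ 2) := by
      rwa [show (N : ℝ) + 2 * (b / 2) / 2 = N + b / 2 by ring] at hturn
    have e1 : (b / 2) ^ 2 ≤ ((N + b / 2) * √(1 - x ^ 2)) ^ 2 := by gcongr
    rw [mul_pow, hsq] at e1
    rw [mul_pow, mul_pow, hR2]
    have e2 : (1 + (N : ℝ) / (N + b)) ^ 2 = 4 * (N + b / 2) ^ 2 / (N + b) ^ 2 := by
      field_simp; ring
    have e3 : (2 : ℝ) ^ 2 * (N / (N + b)) = 4 * (N * (N + b)) / (N + b) ^ 2 := by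
      field_simp; ring
    rw [e2, e3, ← mul_div_assoc]
    refine div_le_div_of_nonneg_right ?_ (by positivity)
    linarith
  have hc := abs_gegenbauerVal_le_sqrt hx0 (by linarith : x ^ 2 < 1) hR0 hR1 hxR j N
  rw [hRb] at hc
  rw [← hR2, pow_mul] at hG
  set σ := √(1 - x ^ 2)
  set q := √((N : ℝ) * (N + b) / b) with hq
  have hd : 0 < b / (N + b) * σ := by positivity
  have hq' : q * (√(b / (N + b) * σ * R))⁻¹ * (b / (N + b) * σ) ≤ 2 * √((N + b / 2) * σ) := by
    have e1 : (√(b / (N + b) * σ * R))⁻¹ * (b / (N + b) * σ) = √(b / (N + b) * σ / R) := by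
      rw [← Real.sqrt_inv, eq_comm, Real.sqrt_eq_iff_eq_sq (by positivity) (by positivity),
        mul_pow, Real.sq_sqrt (by positivity)]
      field_simp
    rw [mul_assoc, e1, hq, ← Real.sqrt_mul (by positivity),
      show (2 : ℝ) = √(2 ^ 2) by rw [Real.sqrt_sq (by norm_num)],
      ← Real.sqrt_mul (by positivity)]
    apply Real.sqrt_le_sqrt
    have e2 : (N : ℝ) * (N + b) / b * (b / (N + b) * σ / R) = N * σ / R := by field_simp
    rw [e2, div_le_iff₀ hR0]
    have e3 : (N : ℝ) * σ ≤ (N + b / 2) * σ := by gcongr; linarith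
    have e4 : 0 ≤ (N + b / 2) * σ := by positivity
    nlinarith
  calc _ ≤ (3 * (R⁻¹ ^ N * ((b / (N + b) * σ) ^ j)⁻¹ * (√(b / (N + b) * σ * R))⁻¹))
        * (4 * q * (R ^ 2) ^ N * ((b / (N + b)) ^ 2) ^ (j + 1)) := by gcongr
    _ = 12 * (q * (√(b / (N + b) * σ * R))⁻¹ * (b / (N + b) * σ))
        * R ^ N * (b / ((N + b) * σ)) ^ (j + 1) := by
      have e1 : R⁻¹ ^ N * (R ^ 2) ^ N = R ^ N := by
        rw [← mul_pow]; congr 1; field_simp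
      have e2 : ((b / (N + b) * σ) ^ j)⁻¹ * ((b / (N + b)) ^ 2) ^ (j + 1)
          = (b / (N + b) * σ) * (b / ((N + b) * σ)) ^ (j + 1) := by
        have : ((b / (N + b) * σ) ^ j)⁻¹
            = (b / (N + b) * σ) * ((b / (N + b) * σ)⁻¹) ^ (j + 1) := by
          rw [pow_succ, mul_comm _ (b / (N + b) * σ)⁻¹, ← mul_assoc, mul_inv_cancel₀ hd.ne',
            one_mul, inv_pow]
        rw [this, mul_assoc, ← mul_pow]; congr 2; field_simp
      calc _ = 12 * q * (√(b / (N + b) * σ * R))⁻¹ * (R⁻¹ ^ N * (R ^ 2) ^ N)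
            * (((b / (N + b) * σ) ^ j)⁻¹ * ((b / (N + b)) ^ 2) ^ (j + 1)) := by ring
        _ = _ := by rw [e1, e2]; ring
    _ ≤ 12 * (2 * √((N + b / 2) * σ)) * R ^ N * (b / ((N + b) * σ)) ^ (j + 1) := by gcongr
    _ = _ := by ring

/-- The exponential rate `((n-k)/(n+k))^{(n-k)/2} (2n/(n+k))^k`. -/
noncomputable def chebRate (n k : ℕ) : ℝ :=
  √(((n : ℝ) - k) / (n + k)) ^ (n - k) * (2 * n / (n + k)) ^ k

theorem chebTau_le_rate {n k : ℕ} (hk : 1 ≤ k) (h : k + 2 ≤ n) :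
    chebTau n k ≤ 4 * √(((n : ℝ) - k) * (n + k) / (2 * k)) * chebRate n k := by
  refine (chebTau_le hk h).trans ?_
  have hs := sqrt_one_sub_rightmostZero_pos h
  have ht := le_mul_sqrt_one_sub_rightmostZero hk h
  rw [chebRate, ← mul_assoc]
  refine mul_le_mul_of_nonneg_left (pow_le_pow_left₀ (by positivity) ?_ _) (by positivity)
  rw [← div_div, div_le_iff₀ hs]
  calc 2 * (k : ℝ) / (n + k) ≤ 2 * (n * √(1 - rightmostZero n k ^ 2)) / (n + k) := by gcongr
    _ = _ := by ring

theorem exists_sq_mul_cube_eq_one {k : ℕ} (hk : 1 ≤ k) :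
    ∃ ε : ℝ, 0 ≤ ε ∧ ε ≤ 1 ∧ (k : ℝ) ^ 2 * ε ^ 3 = 1 := by
  have hk0 : (1 : ℝ) ≤ k := by exact_mod_cast hk
  have h : (1 : ℝ) ≤ ((k : ℝ) ^ 2) ^ (1 / 3 : ℝ) :=
    Real.one_le_rpow (by nlinarith) (by norm_num)
  refine ⟨(((k : ℝ) ^ 2) ^ (1 / 3 : ℝ))⁻¹, by positivity, inv_le_one_of_one_le₀ h, ?_⟩
  rw [inv_pow, ← Real.rpow_natCast, ← Real.rpow_natCast, ← Real.rpow_mul (by positivity)]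
  norm_num
  exact mul_inv_cancel₀ (by positivity)

/-- As `k = (kε)³`, Bernoulli's inequality for a third of the exponent, cubed, bounds `k` by a power
of `1 + ε`. The exponent `k - 1` suffices for this, and the factor `s²` left over pays for `s`. -/
theorem mul_le_pow_of_one_add_le_sq {k : ℕ} {s ε : ℝ} (hs : 1 ≤ s) (hε : 0 ≤ ε)
    (hε1 : ε ≤ 1) (hk : (k : ℝ) ^ 2 * ε ^ 3 = 1) (hsε : 1 + ε ≤ s ^ 2) :
    (k : ℝ) * s ≤ 27 * (s ^ k) ^ 2 := by
  rcases k with _ | k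
  · simp at hk
  set j := k / 3 with hj
  have hjk : 3 * j ≤ k := by omega
  have hjk' : ((k + 1 : ℕ) : ℝ) ≤ 3 * (j + 1) := by exact_mod_cast (by omega : k + 1 ≤ 3 * (j + 1))
  have h1 : ((k + 1 : ℕ) : ℝ) * ε ≤ 3 * (1 + j * ε) := by
    have := mul_le_mul_of_nonneg_right hjk' hε
    linarith
  have h2 : 1 + j * ε ≤ (1 + ε) ^ j := one_add_mul_le_pow (by linarith) j
  have h3 : ((k + 1 : ℕ) : ℝ) ≤ 27 * (s ^ 2) ^ k := by
    calc ((k + 1 : ℕ) : ℝ) = (((k + 1 : ℕ) : ℝ) * ε) ^ 3 := by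
          rw [mul_pow, pow_succ _ 2]; linear_combination (-((k + 1 : ℕ) : ℝ)) * hk
      _ ≤ (3 * (1 + ε) ^ j) ^ 3 := pow_le_pow_left₀ (by positivity) (by linarith) 3
      _ = 27 * (1 + ε) ^ (3 * j) := by ring
      _ ≤ 27 * (1 + ε) ^ k := by
          gcongr
          linarith
      _ ≤ 27 * (s ^ 2) ^ k := by gcongr
  calc ((k + 1 : ℕ) : ℝ) * s ≤ 27 * (s ^ 2) ^ k * s ^ 2 := by
        gcongr
        nlinarith
    _ = 27 * (s ^ (k + 1)) ^ 2 := by ring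

theorem chebTau_le_const_mul_rate {n k : ℕ} (hk : 1 ≤ k) (h : k + 2 ≤ n) (hn : 2 * k ≤ n) :
    chebTau n k ≤ 144 * chebRate n k := by
  refine (chebTau_le_of_two_mul_le hk h hn).trans ?_
  obtain ⟨ε, hε, hε1, hεk⟩ := exists_sq_mul_cube_eq_one hk
  have hz := sq_mul_one_add_le_of_rightmostZero hk h hn hε hε1 hεk.le
  have hs := sqrt_one_sub_rightmostZero_pos h
  have hs' := Real.sqrt_pos.mp hs
  have ht := le_mul_sqrt_one_sub_rightmostZero hk h
  have hk0 : (0 : ℝ) < k := by exact_mod_cast hk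
  have hn0 : (0 : ℝ) < n := by exact_mod_cast (by omega : 0 < n)
  have hsq := Real.sq_sqrt hs'.le
  set σ := √(1 - rightmostZero n k ^ 2)
  set s := n * σ / k with hsdef
  have hs1 : 1 ≤ s := by rw [hsdef, le_div_iff₀ hk0]; linarith
  have hsε : 1 + ε ≤ s ^ 2 := by
    rw [hsdef, div_pow, mul_pow, hsq, le_div_iff₀ (by positivity)]; linarith
  have hmain := mul_le_pow_of_one_add_le_sq hs1 hε hε1 hεk hsε
  -- The gain `s^{-k}` over the turning point bound cancels the prefactor; `6` comes from `27 ≤ 36`.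
  have hroot : √(n * σ) ≤ 6 * s ^ k := by
    rw [Real.sqrt_le_left (by positivity)]
    have : n * σ = k * s := by rw [hsdef]; field_simp
    rw [this]
    nlinarith [sq_nonneg (s ^ k)]
  have hfac : (2 * (k : ℝ) / ((n + k) * σ)) ^ k = (2 * n / (n + k)) ^ k / s ^ k := by
    rw [← div_pow]; congr 1; rw [hsdef]; field_simp
  have hspos : 0 < s ^ k := by positivity
  rw [hfac, chebRate]
  calc _ ≤ 24 * (6 * s ^ k) * √(((n : ℝ) - k) / (n + k)) ^ (n - k)
        * ((2 * n / (n + k)) ^ k / s ^ k) := by gcongr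
    _ = _ := by field_simp; ring

/-! ### Size of the exponential rate -/

/-- This is `artanh(1/a) ≥ 1/a`; it makes the derivative of `logRate` nonpositive. -/
theorem two_div_le_log_sub_log {a : ℝ} (ha : 1 < a) :
    2 / a ≤ Real.log (a + 1) - Real.log (a - 1) := by
  have h0 : 0 < a - 1 := by linarith
  have h := Real.le_log_one_add_of_nonneg (x := 2 / (a - 1)) (by positivity)
  rw [← Real.log_div (by linarith) h0.ne']
  have e1 : 2 * (2 / (a - 1)) / (2 / (a - 1) + 2) = 2 / a := by
    field_simp; ring
  have e2 : 1 + 2 / (a - 1) = (a + 1) / (a - 1) := by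
    field_simp; ring
  rwa [e1, e2] at h

/-- The logarithm of the `k`-th root of `chebRate n k` as a function of `a = n / k`. -/
noncomputable def logRate (a : ℝ) : ℝ :=
  (a - 1) / 2 * (Real.log (a - 1) - Real.log (a + 1)) + Real.log a + Real.log 2
    - Real.log (a + 1)

theorem hasDerivAt_logRate {a : ℝ} (ha : 1 < a) :
    HasDerivAt logRate ((Real.log (a - 1) - Real.log (a + 1)) / 2 + 1 / a) a := by
  have h1 : HasDerivAt (fun a : ℝ => Real.log (a - 1)) (1 / (a - 1)) a :=
    ((hasDerivAt_id a).sub_const 1).log (by simp only [id]; linarith)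
  have h2 : HasDerivAt (fun a : ℝ => Real.log (a + 1)) (1 / (a + 1)) a :=
    ((hasDerivAt_id a).add_const 1).log (by simp only [id]; linarith)
  have h3 : HasDerivAt (fun a : ℝ => (a - 1) / 2) (1 / 2) a :=
    ((hasDerivAt_id a).sub_const 1).div_const 2
  have h4 : HasDerivAt Real.log (1 / a) a := by
    simpa using Real.hasDerivAt_log (by linarith : a ≠ 0)
  refine HasDerivAt.congr_deriv (f := logRate)
    ((((h3.mul (h1.sub h2)).add h4).add_const (Real.log 2)).sub h2) ?_
  have e1 : a - 1 ≠ 0 := by linarith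
  have e2 : a + 1 ≠ 0 := by linarith
  have e3 : a ≠ 0 := by linarith
  simp only [Pi.sub_apply]
  field_simp
  ring

theorem antitoneOn_logRate : AntitoneOn logRate (Set.Ici 2) := by
  apply antitoneOn_of_deriv_nonpos (convex_Ici 2)
  · exact fun a ha => (hasDerivAt_logRate
      (by linarith [Set.mem_Ici.mp ha])).continuousAt.continuousWithinAt
  · exact fun a ha => (hasDerivAt_logRate
      (by linarith [Set.mem_Ici.mp (interior_subset ha)])).differentiableAt.differentiableWithinAt
  · intro a ha
    have ha' : 1 < a := by linarith [Set.mem_Ici.mp (interior_subset ha)]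
    rw [(hasDerivAt_logRate ha').deriv]
    have h := two_div_le_log_sub_log ha'
    have : 2 / a = 2 * (1 / a) := by ring
    linarith

theorem logRate_le {a : ℝ} (ha : 1 < a) : logRate a ≤ Real.log 2 - 1 + (1 / a) ^ 2 := by
  have h := two_div_le_log_sub_log ha
  have ha0 : 0 < a := by linarith
  have h1 := Real.one_sub_inv_le_log_of_pos (x := (a + 1) / a) (by positivity)
  rw [Real.log_div (by positivity) (by positivity)] at h1
  have h2 : (a - 1) / 2 * (2 / a) ≤ (a - 1) / 2 * (Real.log (a + 1) - Real.log (a - 1)) :=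
    mul_le_mul_of_nonneg_left h (by linarith)
  have e1 : (a - 1) / 2 * (2 / a) = 1 - 1 / a := by field_simp
  have e2 : 1 - ((a + 1) / a)⁻¹ = 1 / (a + 1) := by field_simp; ring
  have e3 : 1 / a - 1 / (a + 1) ≤ (1 / a) ^ 2 := by
    rw [div_sub_div _ _ (by positivity) (by positivity), div_pow, div_le_div_iff₀ (by positivity)
      (by positivity)]
    nlinarith
  unfold logRate
  linarith

theorem chebRate_eq_exp {n k : ℕ} (hk : 1 ≤ k) (h : k < n) :
    chebRate n k = Real.exp (k * logRate (n / k)) := by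
  have hk0 : (0 : ℝ) < k := by exact_mod_cast hk
  have hkn : (k : ℝ) < n := by exact_mod_cast h
  have hd : (0 : ℝ) < n - k := by linarith
  have hn0 : (0 : ℝ) < n := by linarith
  have h1 : √(((n : ℝ) - k) / (n + k))
      = Real.exp ((Real.log (n - k) - Real.log (n + k)) / 2) := by
    rw [← Real.log_div hd.ne' (by positivity), Real.exp_half, Real.exp_log (div_pos hd (by positivity))]
  have h2 : 2 * (n : ℝ) / (n + k) = Real.exp (Real.log 2 + Real.log n - Real.log (n + k)) := by
    rw [Real.exp_sub, Real.exp_add, Real.exp_log, Real.exp_log, Real.exp_log] <;> positivity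
  have e1 : (n : ℝ) / k - 1 = (n - k) / k := by field_simp
  have e2 : (n : ℝ) / k + 1 = (n + k) / k := by field_simp
  rw [chebRate, h1, h2, ← Real.exp_nat_mul, ← Real.exp_nat_mul, ← Real.exp_add, logRate, e1, e2,
    Real.log_div hd.ne' hk0.ne', Real.log_div (by positivity) hk0.ne',
    Real.log_div (by positivity) hk0.ne', Nat.cast_sub h.le]
  congr 1
  field_simp
  ring

theorem chebRate_le_of_two_mul_le {n k : ℕ} (hk : 1 ≤ k) (hn : 2 * k ≤ n) :
    chebRate n k ≤ (4 / √27) ^ k := by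
  have hk0 : (0 : ℝ) < k := by exact_mod_cast hk
  have hn' : 2 * (k : ℝ) ≤ n := by exact_mod_cast hn
  have ha : (2 : ℝ) ≤ n / k := by rw [le_div_iff₀ hk0]; exact hn'
  have h2 : Real.exp (logRate 2) = 4 / √27 := by
    have h27 : √27 = 3 * √3 := by
      rw [show (27 : ℝ) = 3 ^ 2 * 3 by norm_num, Real.sqrt_mul (by norm_num),
        Real.sqrt_sq (by norm_num)]
    have e : logRate 2 = Real.log 2 + Real.log 2 - Real.log 3 - Real.log 3 / 2 := by
      unfold logRate
      norm_num
      ring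
    rw [e, Real.exp_sub, Real.exp_sub, Real.exp_add, Real.exp_half, Real.exp_log (by norm_num),
      Real.exp_log (by norm_num), h27]
    field_simp
    norm_num
  rw [chebRate_eq_exp hk (by omega), ← h2, ← Real.exp_nat_mul]
  apply Real.exp_le_exp.mpr
  gcongr
  exact antitoneOn_logRate (Set.mem_Ici.mpr le_rfl) ha ha

theorem chebRate_le_of_cube_le_sq {n k : ℕ} (hk : 1 ≤ k) (h : k < n) (hn : (k : ℝ) ^ 3 ≤ n ^ 2) :
    chebRate n k ≤ Real.exp 1 * (2 / Real.exp 1) ^ k := by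
  have hk0 : (0 : ℝ) < k := by exact_mod_cast hk
  have hkn : (k : ℝ) < n := by exact_mod_cast h
  have hn0 : (0 : ℝ) < n := by linarith
  have h1 := logRate_le (a := (n : ℝ) / k) (by rw [lt_div_iff₀ hk0]; linarith)
  have h2 : (k : ℝ) * (1 / (n / k)) ^ 2 ≤ 1 := by
    have : (k : ℝ) * (1 / (n / k)) ^ 2 = k ^ 3 / n ^ 2 := by field_simp
    rw [this, div_le_one (by positivity)]
    exact hn
  have h3 : 2 / Real.exp 1 = Real.exp (Real.log 2 - 1) := by
    rw [Real.exp_sub, Real.exp_log (by norm_num)]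
  rw [chebRate_eq_exp hk h, h3, ← Real.exp_nat_mul, ← Real.exp_add]
  apply Real.exp_le_exp.mpr
  have := mul_le_mul_of_nonneg_left h1 hk0.le
  linarith

/-- With `y = (n-k)/(n+k)`, the factor `2n/(n+k) = 1 + y` is at most `e^y`, and `ky ≤ (n-k)/2`.
Useful when `n - k` is small compared with `k`. -/
theorem chebRate_le_pow {n k : ℕ} (hk : 1 ≤ k) (h : k < n) :
    chebRate n k ≤ √(Real.exp 1 * ((n - k) / (n + k))) ^ (n - k) := by
  have hk0 : (0 : ℝ) < k := by exact_mod_cast hk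
  have hkn : (k : ℝ) < n := by exact_mod_cast h
  rw [chebRate, Real.sqrt_mul (Real.exp_pos 1).le, mul_pow, mul_comm]
  refine mul_le_mul_of_nonneg_right ?_ (by positivity)
  rw [← Real.exp_half, ← Real.exp_nat_mul, Nat.cast_sub h.le]
  have h1 : 2 * (n : ℝ) / (n + k) ≤ Real.exp ((n - k) / (n + k)) := by
    have h2 := Real.add_one_le_exp (((n : ℝ) - k) / (n + k))
    have h3 : ((n : ℝ) - k) / (n + k) + 1 = 2 * n / (n + k) := by field_simp; ring
    linarith
  refine (pow_le_pow_left₀ (by positivity) h1 k).trans ?_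
  rw [← Real.exp_nat_mul]
  apply Real.exp_le_exp.mpr
  rw [← mul_div_assoc, div_le_iff₀ (by positivity)]
  nlinarith

/-! ### The range n < 2k and the conclusion -/

theorem exists_pow_mul_pow_le (m : ℕ) {q : ℝ} (hq : 0 ≤ q) (hq1 : q < 1) :
    ∃ B : ℝ, 0 < B ∧ ∀ N : ℕ, (N : ℝ) ^ m * q ^ N ≤ B := by
  obtain ⟨B, hB⟩ := (tendsto_pow_const_mul_const_pow_of_abs_lt_one m
    (abs_lt.mpr ⟨by linarith, hq1⟩)).bddAbove_range
  exact ⟨max B 1, by positivity, fun N => (hB ⟨N, rfl⟩).trans (le_max_left _ _)⟩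

theorem rpow_neg_div_two_eq (k m : ℕ) : (k : ℝ) ^ (-(m : ℝ) / 2) = (√k ^ m)⁻¹ := by
  rw [neg_div, Real.rpow_neg (by positivity), Real.sqrt_eq_rpow, ← Real.rpow_natCast,
    ← Real.rpow_mul (by positivity)]
  ring_nf

theorem chebTau_le_of_lt_two_mul {n k m : ℕ} (hk : 1 ≤ k) (h : k + 2 ≤ n) (hm : k + m ≤ n)
    (hn : n < 2 * k) :
    chebTau n k ≤ 8 * 2 ^ m * (√(Real.exp 1 / 3) ^ m)⁻¹
      * (((n - k : ℕ) : ℝ) ^ (m + 1) * √(Real.exp 1 / 3) ^ (n - k)) * (√k ^ m)⁻¹ := by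
  have hk0 : (0 : ℝ) < k := by exact_mod_cast hk
  have hn' : (n : ℝ) ≤ 2 * k := by exact_mod_cast hn.le
  have hcast : ((n - k : ℕ) : ℝ) = n - k := Nat.cast_sub (by omega)
  have hN : (2 : ℝ) ≤ ((n - k : ℕ) : ℝ) := by exact_mod_cast (by omega : 2 ≤ n - k)
  refine (chebTau_le_rate hk h).trans ?_
  have hF := chebRate_le_pow hk (show k < n by omega)
  -- Here `n ≥ k + m` is used: `m` of the `n - k` factors supply `k^{-m/2}`, and the other `l`
  -- supply geometric decay.
  obtain ⟨l, hl⟩ : ∃ l, n - k = m + l := ⟨n - k - m, by omega⟩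
  rw [show (n : ℝ) + k = (n - k) + 2 * k by ring, ← hcast] at hF ⊢
  rw [hl] at hF ⊢
  rw [hl] at hN
  rw [hl] at hcast
  set N : ℝ := ((m + l : ℕ) : ℝ)
  set q := √(Real.exp 1 / 3)
  have hq0 : 0 < q := by positivity
  have hNk : N ≤ k := by linarith
  have he : Real.exp 1 ≤ 2.72 := by linarith [Real.exp_one_lt_d9]
  have h1 : √(N * (N + 2 * k) / (2 * k)) ≤ 2 * N := by
    rw [Real.sqrt_le_left (by positivity), div_le_iff₀ (by positivity)]
    calc N * (N + 2 * k) ≤ N * (N * (8 * k)) := by gcongr; nlinarith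
      _ = (2 * N) ^ 2 * (2 * k) := by ring
  have hw1 : √(Real.exp 1 * (N / (N + 2 * k))) ≤ q := by
    apply Real.sqrt_le_sqrt
    rw [← mul_div_assoc, div_le_div_iff₀ (by positivity) (by norm_num), mul_assoc]
    gcongr
    linarith
  have hw2 : √(Real.exp 1 * (N / (N + 2 * k))) ≤ 2 * N * (√k)⁻¹ := by
    rw [← div_eq_mul_inv, Real.sqrt_le_left (by positivity), div_pow, Real.sq_sqrt hk0.le,
      ← mul_div_assoc, div_le_div_iff₀ (by positivity) hk0]
    have : Real.exp 1 * N * k ≤ 4 * N * k := by gcongr; linarith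
    have h5 : 4 * N * k ≤ 4 * N * (N * (N + 2 * k)) := by
      rw [mul_assoc, mul_assoc]
      have : (k : ℝ) ≤ N * (N + 2 * k) := by nlinarith
      have := mul_le_mul_of_nonneg_left this (show 0 ≤ 4 * N by positivity)
      linarith
    linarith
  have hrate : 0 ≤ chebRate n k := by unfold chebRate; positivity
  have hF' : chebRate n k ≤ (2 * N * (√k)⁻¹) ^ m * q ^ l := by
    refine hF.trans ?_
    rw [pow_add]
    gcongr
  calc 4 * √(N * (N + 2 * k) / (2 * k)) * chebRate n k
      ≤ 4 * (2 * N) * ((2 * N * (√k)⁻¹) ^ m * q ^ l) := by gcongr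
    _ = _ := by
        rw [pow_add q, mul_pow, mul_pow, inv_pow]
        field_simp
        ring

/-- For `k ≥ 4` one has `k³ ≥ 4k²`; of the smaller cases only `k = 3` needs the cube. -/
theorem two_mul_le_of_cube_le_sq {n k : ℕ} (hk : 1 ≤ k) (h : k + 2 ≤ n) (hn : k ^ 3 ≤ n ^ 2) :
    2 * k ≤ n := by
  rcases le_or_gt 4 k with h4 | h4
  · have : (2 * k) ^ 2 ≤ n ^ 2 := by nlinarith [sq_nonneg k]
    exact (Nat.pow_le_pow_iff_left two_ne_zero).mp this
  · interval_cases k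
    · omega
    · omega
    · by_contra! hc
      have : n ≤ 5 := by omega
      have := Nat.pow_le_pow_left this 2
      omega

theorem cube_le_sq_of_rpow_le {n k : ℕ} (hn : (k : ℝ) ^ ((3 : ℝ) / 2) ≤ n) :
    (k : ℝ) ^ 3 ≤ (n : ℝ) ^ 2 := by
  calc (k : ℝ) ^ 3 = ((k : ℝ) ^ ((3 : ℝ) / 2)) ^ 2 := by
        rw [← Real.rpow_natCast, ← Real.rpow_natCast, ← Real.rpow_mul (by positivity)]
        norm_num
    _ ≤ _ := by gcongr

theorem mainTheorem6 :
    (∀ m : ℕ, ∃ C : ℝ, 0 < C ∧ ∀ n k : ℕ, 1 ≤ k → k + 2 ≤ n → k + m ≤ n →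
      chebTau n k ≤ C * (k : ℝ) ^ (-(m : ℝ) / 2)) ∧
    (∃ C : ℝ, 0 < C ∧ ∀ n k : ℕ, 1 ≤ k → k + 2 ≤ n → 2 * k ≤ n →
      chebTau n k ≤ C * (4 / Real.sqrt 27) ^ k) ∧
    (∃ C : ℝ, 0 < C ∧ ∀ n k : ℕ, 1 ≤ k → k + 2 ≤ n → (k : ℝ) ^ ((3 : ℝ) / 2) ≤ (n : ℝ) →
      chebTau n k ≤ C * (2 / Real.exp 1) ^ k) := by
  have hii : ∀ n k : ℕ, 1 ≤ k → k + 2 ≤ n → 2 * k ≤ n →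
      chebTau n k ≤ 144 * (4 / Real.sqrt 27) ^ k := fun n k hk h hn =>
    (chebTau_le_const_mul_rate hk h hn).trans
      (mul_le_mul_of_nonneg_left (chebRate_le_of_two_mul_le hk hn) (by norm_num))
  refine ⟨fun m => ?_, ⟨144, by norm_num, hii⟩, ⟨144 * Real.exp 1, by positivity, ?_⟩⟩
  · have hp1 : 4 / √27 < 1 := by
      rw [div_lt_one (by positivity)]
      exact Real.lt_sqrt_of_sq_lt (by norm_num)
    have hq1 : √(Real.exp 1 / 3) < 1 := by
      rw [Real.sqrt_lt' (by norm_num)]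
      linarith [Real.exp_one_lt_d9]
    obtain ⟨B, hB, hBle⟩ := exists_pow_mul_pow_le m (by positivity) hp1
    obtain ⟨D, hD, hDle⟩ := exists_pow_mul_pow_le (m + 1) (Real.sqrt_nonneg _) hq1
    have hq0 : 0 < √(Real.exp 1 / 3) := by positivity
    refine ⟨144 * B + 8 * 2 ^ m * (√(Real.exp 1 / 3) ^ m)⁻¹ * D, by positivity, ?_⟩
    intro n k hk h hm
    have hk1 : (1 : ℝ) ≤ k := by exact_mod_cast hk
    rw [rpow_neg_div_two_eq]
    have hsk : 0 < √(k : ℝ) := by positivity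
    rcases le_or_gt (2 * k) n with hn | hn
    · refine (hii n k hk h hn).trans ?_
      calc 144 * (4 / √27) ^ k = 144 * (√k ^ m * (4 / √27) ^ k) * (√k ^ m)⁻¹ := by field_simp
        _ ≤ 144 * B * (√k ^ m)⁻¹ := by
            gcongr
            refine le_trans ?_ (hBle k)
            gcongr
            rw [Real.sqrt_le_left (by positivity)]
            nlinarith
        _ ≤ _ := by
            gcongr
            exact le_add_of_nonneg_right (by positivity)
    · refine (chebTau_le_of_lt_two_mul hk h hm hn).trans ?_
      gcongr
      refine le_trans ?_ (le_add_of_nonneg_left (by positivity))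
      gcongr
      exact hDle (n - k)
  · intro n k hk h hn
    have hcube := cube_le_sq_of_rpow_le hn
    have h2 := two_mul_le_of_cube_le_sq hk h (by exact_mod_cast hcube)
    rw [mul_assoc]
    exact (chebTau_le_const_mul_rate hk h h2).trans
      (mul_le_mul_of_nonneg_left (chebRate_le_of_cube_le_sq hk (by omega) hcube) (by norm_num))
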